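/- Let $\overline S_\infty$ be the group of all permutations of $\mathbb N=\{1,2,\dots\}$ with the topology of pointwise convergence, and let $S_\infty\subset\overline S_\infty$ be the subgroup of finitely supported permutations. Put $G=S_\infty\times S_\infty\times S_\infty$, let $\mathbb K\simeq\overline S_\infty$ be the diagonal of $\overline S_\infty\times\overline S_\infty\times\overline S_\infty$, and let $\mathbb G\subset\overline S_\infty\times\overline S_\infty\times\overline S_\infty$ be the subgroup generated by $\mathbb K$ and $G$, with the topology for which $\mathbb K$ carries the topology of $\overline S_\infty$ and $\mathbb G/\mathbb K$ is discrete (a set $U\subset\mathbb G$ is open iff for every $g\in\mathbb G$ the set of all $k\in\mathbb K$ with $gk\in U$ is open in $\mathbb K$). For $\alpha\in\mathbb Z_{+}=\{0,1,2,\dots\}$ let $K[\alpha]\subset G$ be the group of all triples $(h,h,h)$, where $h\in S_\infty$ fixes $1,\dots,\alpha$. Let $\mathcal K$ be the category whose objects are the elements of $\mathbb Z_{+}$ and whose set of morphisms from $\beta$ to $\alpha$ is the set of double cosets $\mathcal M(\alpha,\beta)=K[\alpha]\backslash G/K[\beta]$. The composition $\mathfrak p\circledast\mathfrak q\in\mathcal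 M(\alpha,\gamma)$ of $\mathfrak p\in\mathcal M(\alpha,\beta)$ and $\mathfrak q\in\mathcal M(\beta,\gamma)$ is the stable value, as $j\to\infty$, of the eventually constant sequence $K[\alpha]\,p\,\Theta_j[\beta]\,q\,K[\gamma]$, where $p\in\mathfrak p$, $q\in\mathfrak q$, and $\Theta_j[\beta]=(\theta,\theta,\theta)$ with $\theta$ the permutation that exchanges $\beta+i$ with $\beta+j+i$ for $1\le i\le j$ and fixes all other points; this value does not depend on the choice of $p$ and $q$. The identity of $\alpha$ is the double coset of $1$. The involution $\mathfrak p\mapsto\mathfrak p^*$, $\mathcal M(\alpha,\beta)\to\mathcal M(\beta,\alpha)$, is induced by $p\mapsto p^{-1}$. A $*$-representation of $\mathcal K$ is a functor $F$ from $\mathcal K$ to complex Hilbert spaces and bounded operators (in particular, identities go to identity operators) such that $F(\mathfrak p^*)=F(\mathfrak p)^*$ for all morphisms $\mathfrak p$. Two $*$-representations $F,F'$ are equivalent if there are unitary operators $U_\alpha:F(\alpha)\to F'(\alpha)$, $\alpha\in\mathbb Z_{+}$, with $U_\alpha F(\mathfrak p)=F'(\mathfrak p)U_\beta$ for all $\alpha,\beta$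 and all $\mathfrak p\in\mathcal M(\alpha,\beta)$. For a (strongly continuous) unitary representation $\rho$ of $\mathbb G$ in a complex Hilbert space $V$ let $V[\alpha]$ be the space of $K[\alpha]$-fixed vectors, let $P[\alpha]$ be the orthogonal projection of $V$ onto $V[\alpha]$, and let $\overline\rho$ assign to each object $\alpha$ the space $V[\alpha]$ and to each morphism $\mathfrak p\in\mathcal M(\alpha,\beta)$ the operator $$\overline\rho_{\alpha,\beta}(\mathfrak p)=P[\alpha]\,\rho(p)\big|_{V[\beta]}:V[\beta]\to V[\alpha],\qquad p\in\mathfrak p,$$ which does not depend on the choice of $p$. Then $\overline\rho$ is a $*$-representation of $\mathcal K$ for every unitary representation $\rho$ of $\mathbb G$, and the map $\rho\mapsto\overline\rho$ induces a bijection between the set of unitary representations of $\mathbb G$ up to unitary equivalence and the set of $*$-representations of $\mathcal K$ up to equivalence. -/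

import Mathlib

universe u

open Filter Topology
open CategoryTheory (Category CategoryStruct)

noncomputable section

namespace TriSym

/-! ### Infinite symmetric groups and the tri-symmetric group

The points permuted are the natural numbers `0, 1, 2, …` (instead of `1, 2, 3, …`); the first
`α` points are the numbers `i < α`.  The full symmetric group is `Equiv.Perm ℕ`. -/

/-- The group of finitely supported permutations of `ℕ`. -/
def finPerm : Subgroup (Equiv.Perm ℕ) where
  carrier := {σ | {x | σ x ≠ x}.Finite}
  one_mem' := by simp
  mul_mem' := by
    intro σ τ hσ hτ
    refine (hσ.union hτ).subset ?_
    intro x hx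
    by_contra hn
    simp only [Set.mem_union, Set.mem_ofPred_eq, not_or, not_not] at hn
    exact hx (by rw [Equiv.Perm.mul_apply, hn.2, hn.1])
  inv_mem' := by
    intro σ hσ
    refine hσ.subset ?_
    intro x hx h
    exact hx (Equiv.Perm.inv_eq_iff_eq.mpr h.symm)

/-- The product of three copies of the full symmetric group. -/
abbrev Perm3 : Type := Equiv.Perm ℕ × Equiv.Perm ℕ × Equiv.Perm ℕ

/-- The diagonal embedding `h ↦ (h, h, h)`. -/
def diag : Equiv.Perm ℕ →* Perm3 :=
  (MonoidHom.id _).prod ((MonoidHom.id _).prod (MonoidHom.id _))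

/-- The group `G`, the product of three copies of the finitely supported symmetric group. -/
def finTri : Subgroup Perm3 := finPerm.prod (finPerm.prod finPerm)

/-- The tri-symmetric group: the subgroup of the product of three copies of the full symmetric
group generated by the diagonal and by `G`. -/
def triSym : Subgroup Perm3 := diag.range ⊔ finTri

/-- The topology of pointwise convergence on the full symmetric group: a basic neighbourhood of `σ`
consists of the permutations that agree with `σ` on a finite set. -/
@[reducible] def permTopology : TopologicalSpace (Equiv.Perm ℕ) :=
  TopologicalSpace.induced (fun σ : Equiv.Perm ℕ => (σ : ℕ → ℕ)) inferInstance

/-- The diagonal embedding of the full symmetric group in the tri-symmetric group. -/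
def diagTri : Equiv.Perm ℕ →* triSym :=
  diag.codRestrict triSym fun σ => Subgroup.mem_sup_left ⟨σ, rfl⟩

/-- The embedding of `G` in the tri-symmetric group. -/
def finToTri : finTri →* triSym := Subgroup.inclusion le_sup_right

/-- The topology of the tri-symmetric group for which the diagonal has the natural topology of the
full symmetric group and the space of left cosets of the diagonal is discrete: a set `U` is open
iff for every `g` the set of all `k` with `g · (k, k, k) ∈ U` is open. -/
@[reducible] def triTopology : TopologicalSpace triSym :=
  ⨆ g : triSym, TopologicalSpace.coinduced (fun k => g * diagTri k) permTopology

/-- The permutations that fix the first `α` points. -/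
def stab (α : ℕ) : Subgroup (Equiv.Perm ℕ) where
  carrier := {σ | ∀ i < α, σ i = i}
  one_mem' := fun _ _ => rfl
  mul_mem' := by
    intro σ τ hσ hτ i hi
    rw [Equiv.Perm.mul_apply, hτ i hi, hσ i hi]
  inv_mem' := fun hσ i hi => Equiv.Perm.inv_eq_iff_eq.mpr (hσ i hi).symm

/-- The subgroup `K[α]` of `G`: the triples `(h, h, h)` with `h` finitely supported and fixing the
first `α` points. -/
def subK (α : ℕ) : Subgroup finTri := ((stab α).map diag).subgroupOf finTri

/-- The space of double cosets `K[α] \ G / K[β]`. -/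
abbrev Cosets (α β : ℕ) : Type := DoubleCoset.Quotient (subK α : Set finTri) (subK β)

/-- The double coset `K[α] · p · K[β]`. -/
abbrev cosetMk (α β : ℕ) (p : finTri) : Cosets α β := DoubleCoset.mk (subK α) (subK β) p

/-- The permutation that exchanges the block `β, …, β + j - 1` with the block
`β + j, …, β + 2 j - 1`, preserving the order in the blocks, and fixes all other points. -/
def thetaPerm (β j : ℕ) : Equiv.Perm ℕ :=
  Function.Involutive.toPerm
    (fun x => if x < β then x else if x < β + j then x + j else if x < β + 2 * j then x - j else x)
    (by intro x; dsimp only; split_ifs <;> omega)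

lemma thetaPerm_apply (β j x : ℕ) : thetaPerm β j x =
    if x < β then x else if x < β + j then x + j else if x < β + 2 * j then x - j else x := rfl

lemma thetaPerm_mem (β j : ℕ) : thetaPerm β j ∈ finPerm := by
  refine (Set.finite_lt_nat (β + 2 * j)).subset ?_
  intro x hx
  by_contra hn
  apply hx
  simp only [Set.mem_ofPred_eq] at hn
  rw [thetaPerm_apply]
  split_ifs <;> omega

/-- The diagonal element of `G` with finitely supported component `σ`. -/
def diagFin (σ : Equiv.Perm ℕ) (h : σ ∈ finPerm) : finTri := ⟨diag σ, h, h, h⟩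

/-- The element `Θ_j[β]` of `G`. -/
def Theta (β j : ℕ) : finTri := diagFin (thetaPerm β j) (thetaPerm_mem β j)

/-! ### The product of double cosets -/

lemma mem_subK {α : ℕ} {g : finTri} :
    g ∈ subK α ↔ ∃ σ, ∃ h : σ ∈ finPerm, (∀ i < α, σ i = i) ∧ g = diagFin σ h := by
  constructor
  · rintro ⟨σ, hσ, hg⟩
    have hf : σ ∈ finPerm := by
      have h1 : (g : Perm3).1 ∈ finPerm := g.2.1
      have h2 : (g : Perm3).1 = σ := by rw [← Subgroup.coe_subtype, ← hg]; rfl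
      rwa [h2] at h1
    exact ⟨σ, hf, hσ, Subtype.ext hg.symm⟩
  · rintro ⟨σ, h, hσ, rfl⟩
    exact ⟨σ, hσ, rfl⟩

/-- All three components of `g` fix all points outside `A`. -/
def SuppIn (A : Finset ℕ) (g : finTri) : Prop :=
  ∀ x ∉ A, g.1.1 x = x ∧ g.1.2.1 x = x ∧ g.1.2.2 x = x

lemma SuppIn.mono {A B : Finset ℕ} {g : finTri} (h : SuppIn A g) (hAB : A ⊆ B) : SuppIn B g :=
  fun x hx => h x fun hA => hx (hAB hA)

lemma SuppIn.mul {A : Finset ℕ} {g h : finTri} (hg : SuppIn A g) (hh : SuppIn A h) :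
    SuppIn A (g * h) := by
  intro x hx
  obtain ⟨a, b, c⟩ := hg x hx
  obtain ⟨a', b', c'⟩ := hh x hx
  refine ⟨?_, ?_, ?_⟩
  · change g.1.1 (h.1.1 x) = x
    rw [a', a]
  · change g.1.2.1 (h.1.2.1 x) = x
    rw [b', b]
  · change g.1.2.2 (h.1.2.2 x) = x
    rw [c', c]

lemma exists_suppIn (g : finTri) : ∃ N, ∀ n ≥ N, SuppIn (Finset.range n) g := by
  have h : ({x | g.1.1 x ≠ x} ∪ ({x | g.1.2.1 x ≠ x} ∪ {x | g.1.2.2 x ≠ x})).Finite :=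
    g.2.1.union (g.2.2.1.union g.2.2.2)
  obtain ⟨N, hN⟩ := h.bddAbove
  refine ⟨N + 1, fun n hn x hx => ?_⟩
  have hx' : ¬ x ≤ N := by
    simp only [Finset.mem_range] at hx
    omega
  have := fun hm => hx' (hN (a := x) hm)
  exact ⟨by_contra fun e => this (Or.inl e), by_contra fun e => this (Or.inr (Or.inl e)),
    by_contra fun e => this (Or.inr (Or.inr e))⟩

/-- A diagonal element that fixes `B` pointwise commutes with the elements supported in `B`. -/
lemma SuppIn.comm {B : Finset ℕ} {p : finTri} (hp : SuppIn B p) {a : Equiv.Perm ℕ}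
    (ha : a ∈ finPerm) (haB : ∀ y ∈ B, a y = y) : p * diagFin a ha = diagFin a ha * p := by
  have key : ∀ s : Equiv.Perm ℕ, (∀ x ∉ B, s x = x) → s * a = a * s := by
    intro s hs
    have hd : Equiv.Perm.Disjoint s a := by
      intro x
      by_cases hx : x ∈ B
      · exact Or.inr (haB x hx)
      · exact Or.inl (hs x hx)
    exact hd.commute
  apply Subtype.ext
  refine Prod.ext (key _ fun x hx => (hp x hx).1) (Prod.ext (key _ fun x hx => (hp x hx).2.1)
    (key _ fun x hx => (hp x hx).2.2))

/-- A finite partial injection extends to a finitely supported permutation. -/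
lemma exists_extension (D : Finset ℕ) (f : ℕ → ℕ) (hf : Set.InjOn f D) :
    ∃ b ∈ finPerm, ∀ x ∈ D, b x = f x := by
  classical
  let T : Finset ℕ := D ∪ D.image f
  obtain ⟨g, hg⟩ := Set.MapsTo.exists_equiv_extend_of_card_eq (α := T) (t := T) (by simp)
    (s := {x | x.1 ∈ D}) (f := fun x => f x.1)
    (by
      intro x hx
      exact Finset.mem_union_right _ (Finset.mem_image_of_mem f hx))
    (by
      intro x hx y hy hxy
      exact Subtype.ext (hf hx hy hxy))
  refine ⟨Equiv.Perm.ofSubtype g, ?_, ?_⟩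
  · refine T.finite_toSet.subset ?_
    intro x hx
    by_contra hn
    exact hx (Equiv.Perm.ofSubtype_apply_of_not_mem g hn)
  · intro x hx
    have hxT : x ∈ T := Finset.mem_union_left _ hx
    rw [Equiv.Perm.ofSubtype_apply_of_mem g hxT]
    exact hg ⟨x, hxT⟩ hx

lemma exists_two_sided {σ τ : Equiv.Perm ℕ} (hσ : σ ∈ finPerm) (hτ : τ ∈ finPerm)
    (A B : Finset ℕ) (h : ∀ x ∈ A, ∀ y ∈ B, σ x = y ↔ τ x = y) :
    ∃ a ∈ finPerm, ∃ b ∈ finPerm, (∀ y ∈ B, a y = y) ∧ (∀ x ∈ A, b x = x) ∧ τ = a * σ * b := by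
  classical
  let f : ℕ → ℕ := fun x => if x ∈ A then x else σ⁻¹ (τ x)
  have hfA : ∀ x ∈ A, f x = x := fun x hx => if_pos hx
  have hfA' : ∀ x ∉ A, f x = σ⁻¹ (τ x) := fun x hx => if_neg hx
  have hfB : ∀ x, τ x ∈ B → f x = σ⁻¹ (τ x) := by
    intro x hx
    by_cases hxA : x ∈ A
    · rw [hfA x hxA, Equiv.Perm.eq_inv_iff_eq]
      exact (h x hxA _ hx).mpr rfl
    · exact hfA' x hxA
  let D : Finset ℕ := A ∪ B.image fun y => τ⁻¹ y
  have hD : ∀ x ∈ D, x ∉ A → τ x ∈ B := by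
    intro x hx hxA
    rcases Finset.mem_union.mp hx with h1 | h1
    · exact absurd h1 hxA
    · obtain ⟨y, hy, rfl⟩ := Finset.mem_image.mp h1
      simpa using hy
  have cross : ∀ x ∈ A, ∀ x' ∈ D, x' ∉ A → f x = f x' → x = x' := by
    intro x hx x' hx' hxA' he
    rw [hfA x hx, hfA' x' hxA', Equiv.Perm.eq_inv_iff_eq] at he
    exact τ.injective ((h x hx _ (hD x' hx' hxA')).mp he)
  have hinj : Set.InjOn f D := by
    intro x hx x' hx' he
    by_cases hxA : x ∈ A <;> by_cases hxA' : x' ∈ A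
    · rwa [hfA x hxA, hfA x' hxA'] at he
    · exact cross x hxA x' hx' hxA' he
    · exact (cross x' hxA' x hx hxA he.symm).symm
    · rw [hfA' x hxA, hfA' x' hxA'] at he
      exact τ.injective (σ⁻¹.injective he)
  obtain ⟨b, hb, hbf⟩ := exists_extension D f hinj
  refine ⟨τ * b⁻¹ * σ⁻¹, finPerm.mul_mem (finPerm.mul_mem hτ (finPerm.inv_mem hb))
    (finPerm.inv_mem hσ), b, hb, ?_, ?_, ?_⟩
  · intro y hy
    have hyD : τ⁻¹ y ∈ D := Finset.mem_union_right _ (Finset.mem_image_of_mem _ hy)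
    have h1 : b (τ⁻¹ y) = σ⁻¹ y := by
      rw [hbf _ hyD, hfB _ (by simpa using hy)]
      simp
    have h2 : b⁻¹ (σ⁻¹ y) = τ⁻¹ y := Equiv.Perm.inv_eq_iff_eq.mpr h1.symm
    rw [Equiv.Perm.mul_apply, Equiv.Perm.mul_apply, h2]
    simp
  · intro x hx
    rw [hbf x (Finset.mem_union_left _ hx), hfA x hx]
  · group

/-- `σ` fixes the first `β` points and moves no other point of `A` into `B`. -/
def Separates (β : ℕ) (A B : Finset ℕ) (σ : Equiv.Perm ℕ) : Prop :=
  (∀ i < β, σ i = i) ∧ ∀ x ∈ A, σ x ∈ B → x < β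

lemma separates_theta {β n j : ℕ} (hj : n ≤ j) :
    Separates β (Finset.range n) (Finset.range n) (thetaPerm β j) := by
  constructor
  · intro i hi
    rw [thetaPerm_apply, if_pos hi]
  · intro x hx hy
    rw [thetaPerm_apply] at hy
    simp only [Finset.mem_range] at hx hy
    split_ifs at hy <;> omega

lemma Separates.mono {β : ℕ} {A B A' B' : Finset ℕ} {σ : Equiv.Perm ℕ} (h : Separates β A B σ)
    (hA : A' ⊆ A) (hB : B' ⊆ B) : Separates β A' B' σ :=
  ⟨h.1, fun x hx hy => h.2 x (hA hx) (hB hy)⟩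

lemma coset_eq_of_separates {α β γ : ℕ} {A B : Finset ℕ} {p q : finTri} (hp : SuppIn B p)
    (hq : SuppIn A q) (hα : Finset.range α ⊆ B) (hγ : Finset.range γ ⊆ A) {σ τ : Equiv.Perm ℕ}
    (hσ : σ ∈ finPerm) (hτ : τ ∈ finPerm) (sσ : Separates β A B σ) (sτ : Separates β A B τ) :
    cosetMk α γ (p * diagFin σ hσ * q) = cosetMk α γ (p * diagFin τ hτ * q) := by
  obtain ⟨a, ha, b, hb, haB, hbA, rfl⟩ := exists_two_sided hσ hτ A B (by
    intro x hx y hy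
    constructor
    · intro h
      have hlt := sσ.2 x hx (h ▸ hy)
      rw [sτ.1 x hlt, ← h, sσ.1 x hlt]
    · intro h
      have hlt := sτ.2 x hx (h ▸ hy)
      rw [sσ.1 x hlt, ← h, sτ.1 x hlt])
  rw [DoubleCoset.eq]
  refine ⟨diagFin a ha, mem_subK.mpr ⟨a, ha, fun i hi => haB i (hα (Finset.mem_range.mpr hi)), rfl⟩,
    diagFin b hb, mem_subK.mpr ⟨b, hb, fun i hi => hbA i (hγ (Finset.mem_range.mpr hi)), rfl⟩, ?_⟩
  have e : diagFin (a * σ * b) hτ = diagFin a ha * diagFin σ hσ * diagFin b hb := rfl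
  have e1 := hp.comm ha haB
  have e2 := hq.comm hb hbA
  calc p * diagFin (a * σ * b) hτ * q
      = (p * diagFin a ha) * diagFin σ hσ * (diagFin b hb * q) := by rw [e]; group
    _ = diagFin a ha * (p * diagFin σ hσ * q) * diagFin b hb := by rw [e1, ← e2]; group

/-- A permutation supported in the first `n` points preserves the set of these points. -/
lemma lt_of_suppIn {n : ℕ} {k : Equiv.Perm ℕ} {hk : k ∈ finPerm}
    (h : SuppIn (Finset.range n) (diagFin k hk)) {x : ℕ} (hx : k x < n) : x < n := by
  by_contra hn
  have h1 : k x = x := (h x (by simpa using hn)).1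
  omega

/-- The double cosets `K[α] · p · Θ_j[β] · q · K[γ]` stabilize for large `j`, and the stable value
depends only on the double cosets of `p` and of `q`. -/
lemma exists_limit {α β γ : ℕ} (P : Cosets α β) (Q : Cosets β γ) :
    ∃ R : Cosets α γ, ∀ p q : finTri, cosetMk α β p = P → cosetMk β γ q = Q →
      ∀ᶠ j in atTop, cosetMk α γ (p * Theta β j * q) = R := by
  obtain ⟨p₀, rfl⟩ : ∃ p₀, cosetMk α β p₀ = P := ⟨_, DoubleCoset.out_eq' _ _ P⟩
  obtain ⟨q₀, rfl⟩ : ∃ q₀, cosetMk β γ q₀ = Q := ⟨_, DoubleCoset.out_eq' _ _ Q⟩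
  obtain ⟨N₁, hN₁⟩ := exists_suppIn p₀
  obtain ⟨N₂, hN₂⟩ := exists_suppIn q₀
  let N := max (max N₁ N₂) (max α γ)
  have hα : Finset.range α ⊆ Finset.range N := Finset.range_mono (by omega)
  have hγ : Finset.range γ ⊆ Finset.range N := Finset.range_mono (by omega)
  refine ⟨cosetMk α γ (p₀ * Theta β N * q₀), fun p q hp hq => ?_⟩
  rw [eq_comm, DoubleCoset.eq] at hp hq
  obtain ⟨h, hh, k, hk, rfl⟩ := hp
  obtain ⟨k', hk', l, hl, rfl⟩ := hq
  obtain ⟨κ, hκ, hκβ, rfl⟩ := mem_subK.mp hk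
  obtain ⟨κ', hκ', hκβ', rfl⟩ := mem_subK.mp hk'
  obtain ⟨N₃, hN₃⟩ := exists_suppIn (diagFin κ hκ)
  obtain ⟨N₄, hN₄⟩ := exists_suppIn (diagFin κ' hκ')
  filter_upwards [eventually_ge_atTop (max N (max N₃ N₄))] with j hj
  have sκ := hN₃ j (by omega)
  have sκ' := hN₄ j (by omega)
  have hNj : Finset.range N ⊆ Finset.range j := Finset.range_mono (by omega)
  have sep := separates_theta (β := β) (le_refl j)
  have hm : κ * thetaPerm β j * κ' ∈ finPerm :=
    finPerm.mul_mem (finPerm.mul_mem hκ (thetaPerm_mem β j)) hκ'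
  have sep' : Separates β (Finset.range j) (Finset.range j) (κ * thetaPerm β j * κ') := by
    constructor
    · intro i hi
      rw [Equiv.Perm.mul_apply, Equiv.Perm.mul_apply, hκβ' i hi, sep.1 i hi, hκβ i hi]
    · intro x hx hy
      rw [Equiv.Perm.mul_apply, Equiv.Perm.mul_apply, Finset.mem_range] at hy
      have h1 : thetaPerm β j (κ' x) < j := lt_of_suppIn sκ hy
      have hx' : κ' x < j := by
        by_contra hn
        have h2 : κ' (κ' x) = κ' x := (sκ' (κ' x) (by simpa using hn)).1
        have h3 := κ'.injective h2
        rw [Finset.mem_range] at hx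
        omega
      have h2 : κ' x < β := sep.2 _ (by simpa using hx') (by simpa using h1)
      have h3 := κ'.injective (hκβ' _ h2)
      omega
  calc cosetMk α γ (h * p₀ * diagFin κ hκ * Theta β j * (diagFin κ' hκ' * q₀ * l))
      = cosetMk α γ (p₀ * diagFin (κ * thetaPerm β j * κ') hm * q₀) := by
        rw [eq_comm, DoubleCoset.eq]
        refine ⟨h, hh, l, hl, ?_⟩
        have e : diagFin (κ * thetaPerm β j * κ') hm
          = diagFin κ hκ * Theta β j * diagFin κ' hκ' := rfl
        rw [e]
        group
    _ = cosetMk α γ (p₀ * Theta β j * q₀) :=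
        coset_eq_of_separates (β := β) (hN₁ j (by omega)) (hN₂ j (by omega)) (hα.trans hNj)
          (hγ.trans hNj) hm (thetaPerm_mem β j) sep' sep
    _ = cosetMk α γ (p₀ * Theta β N * q₀) :=
        coset_eq_of_separates (β := β) (hN₁ N (by omega)) (hN₂ N (by omega)) hα hγ
          (thetaPerm_mem β j) (thetaPerm_mem β N) (sep.mono hNj hNj) (separates_theta le_rfl)

/-- The product `P ⊛ Q` of double cosets: the stable value of the sequence
`K[α] · p · Θ_j[β] · q · K[γ]`, where `p` and `q` are representatives of `P` and `Q`. -/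
def circ {α β γ : ℕ} (P : Cosets α β) (Q : Cosets β γ) : Cosets α γ := (exists_limit P Q).choose

lemma circ_spec {α β γ : ℕ} (p q : finTri) :
    ∀ᶠ j in atTop, cosetMk α γ (p * Theta β j * q) = circ (cosetMk α β p) (cosetMk β γ q) :=
  (exists_limit (cosetMk α β p) (cosetMk β γ q)).choose_spec p q rfl rfl

lemma circ_mk {α β γ : ℕ} {A B : Finset ℕ} {p q : finTri} (hp : SuppIn B p)
    (hq : SuppIn A q) (hα : Finset.range α ⊆ B) (hγ : Finset.range γ ⊆ A) {σ : Equiv.Perm ℕ}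
    (hσ : σ ∈ finPerm) (sσ : Separates β A B σ) :
    circ (cosetMk α β p) (cosetMk β γ q) = cosetMk α γ (p * diagFin σ hσ * q) := by
  obtain ⟨n, hn⟩ := (A ∪ B).exists_nat_subset_range
  obtain ⟨j, h1, h2⟩ := ((circ_spec (α := α) (β := β) (γ := γ) p q).and
    (eventually_ge_atTop n)).exists
  rw [← h1]
  exact coset_eq_of_separates (β := β) hp hq hα hγ (thetaPerm_mem β j) hσ
    ((separates_theta h2).mono (Finset.subset_union_left.trans hn)
      (Finset.subset_union_right.trans hn)) sσ

/-- The involution `P ↦ P*` on double cosets, induced by `p ↦ p⁻¹`. -/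
def starCoset {α β : ℕ} : Cosets α β → Cosets β α :=
  Quotient.map' (fun p => p⁻¹) (by
    intro p q h
    obtain ⟨a, ha, b, hb, rfl⟩ := DoubleCoset.rel_iff.mp h
    refine DoubleCoset.rel_iff.mpr ⟨b⁻¹, inv_mem hb, a⁻¹, inv_mem ha, ?_⟩
    group)

/-- The permutation that exchanges `x` with `x + s` for `β ≤ x < n`. -/
def blockSwap (β n s : ℕ) (h : n ≤ s) : Equiv.Perm ℕ :=
  Function.Involutive.toPerm
    (fun x => if β ≤ x ∧ x < n then x + s else if β + s ≤ x ∧ x < n + s then x - s else x)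
    (by intro x; dsimp only; split_ifs <;> omega)

lemma blockSwap_apply (β n s : ℕ) (h : n ≤ s) (x : ℕ) : blockSwap β n s h x =
    if β ≤ x ∧ x < n then x + s else if β + s ≤ x ∧ x < n + s then x - s else x := rfl

lemma blockSwap_mem (β n s : ℕ) (h : n ≤ s) : blockSwap β n s h ∈ finPerm := by
  refine (Set.finite_lt_nat (n + s)).subset ?_
  intro x hx
  by_contra hn
  apply hx
  simp only [Set.mem_ofPred_eq] at hn
  rw [blockSwap_apply]
  split_ifs <;> omega

lemma circ_assoc {α β γ δ : ℕ} (P : Cosets α β) (Q : Cosets β γ) (R : Cosets γ δ) :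
    circ (circ P Q) R = circ P (circ Q R) := by
  obtain ⟨p, rfl⟩ : ∃ p, cosetMk α β p = P := ⟨_, DoubleCoset.out_eq' _ _ P⟩
  obtain ⟨q, rfl⟩ : ∃ q, cosetMk β γ q = Q := ⟨_, DoubleCoset.out_eq' _ _ Q⟩
  obtain ⟨r, rfl⟩ : ∃ r, cosetMk γ δ r = R := ⟨_, DoubleCoset.out_eq' _ _ R⟩
  obtain ⟨Np, hNp⟩ := exists_suppIn p
  obtain ⟨Nq, hNq⟩ := exists_suppIn q
  obtain ⟨Nr, hNr⟩ := exists_suppIn r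
  obtain ⟨N, hN⟩ : ∃ N, N = Np + Nq + Nr + α + β + γ + δ := ⟨_, rfl⟩
  have sp := hNp N (by omega)
  have sq := hNq N (by omega)
  have sr := hNr N (by omega)
  have r1 : Finset.range α ⊆ Finset.range N := Finset.range_mono (by omega)
  have r2 : Finset.range γ ⊆ Finset.range N := Finset.range_mono (by omega)
  have r3 : Finset.range β ⊆ Finset.range N := Finset.range_mono (by omega)
  have r4 : Finset.range δ ⊆ Finset.range N := Finset.range_mono (by omega)
  have r5 : Finset.range N ⊆ Finset.range (2 * N) := Finset.range_mono (by omega)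
  have hN2 : N ≤ 2 * N := by omega
  have mθ := blockSwap_mem β N N le_rfl
  have mψ := blockSwap_mem γ N (2 * N) hN2
  let A : Finset ℕ := (Finset.range (3 * N)).filter fun x => x < N ∨ 2 * N ≤ x
  have hA : ∀ x, x ∈ A ↔ x < 3 * N ∧ (x < N ∨ 2 * N ≤ x) := by
    intro x
    simp [A]
  have r6 : Finset.range N ⊆ A := by
    intro x hx
    rw [Finset.mem_range] at hx
    exact (hA x).mpr (by omega)
  have sθ : SuppIn (Finset.range (2 * N)) (diagFin _ mθ) := by
    intro x hx
    rw [Finset.mem_range] at hx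
    have : blockSwap β N N le_rfl x = x := by
      rw [blockSwap_apply]
      split_ifs <;> omega
    exact ⟨this, this, this⟩
  have sψ : SuppIn A (diagFin _ mψ) := by
    intro x hx
    rw [hA] at hx
    have : blockSwap γ N (2 * N) hN2 x = x := by
      rw [blockSwap_apply]
      split_ifs <;> omega
    exact ⟨this, this, this⟩
  have sepθ : Separates β A (Finset.range N) (blockSwap β N N le_rfl) := by
    constructor
    · intro i hi
      rw [blockSwap_apply]
      split_ifs <;> omega
    · intro x hx hy
      rw [hA] at hx
      rw [Finset.mem_range, blockSwap_apply] at hy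
      split_ifs at hy <;> omega
  have sepψ : Separates γ (Finset.range N) (Finset.range (2 * N)) (blockSwap γ N (2 * N) hN2) := by
    constructor
    · intro i hi
      rw [blockSwap_apply]
      split_ifs <;> omega
    · intro x hx hy
      rw [Finset.mem_range] at hx
      rw [Finset.mem_range, blockSwap_apply] at hy
      split_ifs at hy <;> omega
  rw [circ_mk sp sq r1 r2 mθ (sepθ.mono r6 subset_rfl),
    circ_mk sq sr r3 r4 mψ (sepψ.mono subset_rfl r5),
    circ_mk (((sp.mono r5).mul sθ).mul (sq.mono r5)) sr (r1.trans r5) r4 mψ sepψ,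
    circ_mk sp (((sq.mono r6).mul sψ).mul (sr.mono r6)) r1 (r4.trans r6) mθ sepθ]
  simp only [mul_assoc]

lemma one_circ {α β : ℕ} (P : Cosets α β) : circ (cosetMk α α 1) P = P := by
  obtain ⟨p, rfl⟩ : ∃ p, cosetMk α β p = P := ⟨_, DoubleCoset.out_eq' _ _ P⟩
  obtain ⟨j, hj⟩ := (circ_spec (α := α) (β := α) (γ := β) 1 p).exists
  rw [← hj, eq_comm, DoubleCoset.eq]
  refine ⟨Theta α j, mem_subK.mpr ⟨_, thetaPerm_mem α j, (separates_theta (le_refl j)).1, rfl⟩, 1,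
    one_mem _, ?_⟩
  group

lemma circ_one {α β : ℕ} (P : Cosets α β) : circ P (cosetMk β β 1) = P := by
  obtain ⟨p, rfl⟩ : ∃ p, cosetMk α β p = P := ⟨_, DoubleCoset.out_eq' _ _ P⟩
  obtain ⟨j, hj⟩ := (circ_spec (α := α) (β := β) (γ := β) p 1).exists
  rw [← hj, eq_comm, DoubleCoset.eq]
  refine ⟨1, one_mem _, Theta β j,
    mem_subK.mpr ⟨_, thetaPerm_mem β j, (separates_theta (le_refl j)).1, rfl⟩, ?_⟩
  group

/-! ### The category of double cosets and its representations -/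

/-- The objects of the category `𝒦`: one object for each non-negative integer. -/
structure ObjK : Type where
  /-- The non-negative integer that labels the object. -/
  level : ℕ

/-- The category `𝒦`: the morphisms from `β` to `α` are the double cosets `K[α] \ G / K[β]`, and
the composition of `P : β → α` with `Q : γ → β` is `P ⊛ Q`. -/
instance : Category ObjK where
  Hom X Y := Cosets Y.level X.level
  id X := cosetMk X.level X.level 1
  comp f g := circ g f
  id_comp f := circ_one f
  comp_id f := one_circ f
  assoc f g h := (circ_assoc h g f).symm

/-- The involution of the category `𝒦`. -/
def starHom {X Y : ObjK} (f : X ⟶ Y) : Y ⟶ X := starCoset f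

/-- A family of complex Hilbert spaces and bounded operators indexed by the objects and the
morphisms of the category `𝒦`, without any compatibility. -/
structure OperatorFamily where
  /-- The Hilbert space assigned to an object. -/
  space : ObjK → Type u
  [normedAddCommGroup : ∀ X, NormedAddCommGroup (space X)]
  [innerProductSpace : ∀ X, InnerProductSpace ℂ (space X)]
  [completeSpace : ∀ X, CompleteSpace (space X)]
  /-- The bounded operator assigned to a morphism. -/
  map : ∀ {X Y : ObjK}, (X ⟶ Y) → (space X →L[ℂ] space Y)

attribute [instance] OperatorFamily.normedAddCommGroup OperatorFamily.innerProductSpace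
  OperatorFamily.completeSpace

/-- The family is a `*`-representation of the category `𝒦`: a functor to Hilbert spaces and bounded
operators that sends the involution of the category to the adjoint. -/
structure OperatorFamily.IsStarRep (F : OperatorFamily.{u}) : Prop where
  map_id : ∀ X : ObjK, F.map (CategoryStruct.id X) = ContinuousLinearMap.id ℂ (F.space X)
  map_comp : ∀ {X Y Z : ObjK} (f : X ⟶ Y) (g : Y ⟶ Z),
    F.map (CategoryStruct.comp f g) = (F.map g).comp (F.map f)
  map_star : ∀ {X Y : ObjK} (f : X ⟶ Y), F.map (starHom f) = ContinuousLinearMap.adjoint (F.map f)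

/-- The `*`-representations of the category `𝒦`. -/
def StarRep : Type (u + 1) := {F : OperatorFamily.{u} // F.IsStarRep}

/-- Unitary equivalence of `*`-representations of `𝒦`: unitary operators `U_α`, one for each object,
that intertwine the operators of the two representations. -/
instance StarRep.setoid : Setoid StarRep.{u} where
  r F E := ∃ U : ∀ X : ObjK, F.1.space X ≃ₗᵢ[ℂ] E.1.space X,
    ∀ (X Y : ObjK) (f : X ⟶ Y) (v : F.1.space X), U Y (F.1.map f v) = E.1.map f (U X v)
  iseqv := by
    refine ⟨fun F => ⟨fun X => LinearIsometryEquiv.refl ℂ _, fun _ _ _ _ => rfl⟩, ?_, ?_⟩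
    · rintro F E ⟨U, hU⟩
      refine ⟨fun X => (U X).symm, fun X Y f v => ?_⟩
      rw [LinearIsometryEquiv.symm_apply_eq, hU, LinearIsometryEquiv.apply_symm_apply]
    · rintro F E D ⟨U, hU⟩ ⟨W, hW⟩
      refine ⟨fun X => (U X).trans (W X), fun X Y f v => ?_⟩
      simp only [LinearIsometryEquiv.trans_apply, hU, hW]

/-! ### Unitary representations of the tri-symmetric group -/

/-- A unitary representation of the tri-symmetric group: a strongly continuous homomorphism to the
unitary group of a complex Hilbert space. -/
structure UnitaryRep where
  /-- The Hilbert space of the representation. -/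
  space : Type u
  [normedAddCommGroup : NormedAddCommGroup space]
  [innerProductSpace : InnerProductSpace ℂ space]
  [completeSpace : CompleteSpace space]
  /-- The unitary operators of the representation. -/
  rho : triSym →* (space ≃ₗᵢ[ℂ] space)
  strongly_continuous : ∀ v : space, Continuous[triTopology, inferInstance] fun g => rho g v

attribute [instance] UnitaryRep.normedAddCommGroup UnitaryRep.innerProductSpace
  UnitaryRep.completeSpace

namespace UnitaryRep

/-- Unitary equivalence of unitary representations. -/
instance setoid : Setoid UnitaryRep.{u} where
  r ρ π := ∃ U : ρ.space ≃ₗᵢ[ℂ] π.space, ∀ (g : triSym) (v : ρ.space),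
    U (ρ.rho g v) = π.rho g (U v)
  iseqv := by
    refine ⟨fun ρ => ⟨LinearIsometryEquiv.refl ℂ _, fun _ _ => rfl⟩, ?_, ?_⟩
    · rintro ρ π ⟨U, hU⟩
      refine ⟨U.symm, fun g v => ?_⟩
      rw [LinearIsometryEquiv.symm_apply_eq, hU, LinearIsometryEquiv.apply_symm_apply]
    · rintro ρ π σ ⟨U, hU⟩ ⟨W, hW⟩
      refine ⟨U.trans W, fun g v => ?_⟩
      simp only [LinearIsometryEquiv.trans_apply, hU, hW]

/-- The unitary operator of an element of the subgroup `G` of the tri-symmetric group. -/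
def op (ρ : UnitaryRep.{u}) (p : finTri) : ρ.space ≃ₗᵢ[ℂ] ρ.space := ρ.rho (finToTri p)

lemma op_mul (ρ : UnitaryRep.{u}) (p q : finTri) (v : ρ.space) :
    ρ.op (p * q) v = ρ.op p (ρ.op q v) := by
  simp only [op, map_mul]
  rfl

lemma op_inv_op (ρ : UnitaryRep.{u}) (p : finTri) (v : ρ.space) : ρ.op p⁻¹ (ρ.op p v) = v := by
  rw [← op_mul, inv_mul_cancel]
  simp only [op, map_one]
  rfl

/-- The space `V[α]` of vectors fixed by the subgroup `K[α]`. -/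
def fixed (ρ : UnitaryRep.{u}) (α : ℕ) : Submodule ℂ ρ.space where
  carrier := {v | ∀ h ∈ subK α, ρ.op h v = v}
  zero_mem' := fun _ _ => map_zero _
  add_mem' := by
    intro v w hv hw h hh
    rw [map_add, hv h hh, hw h hh]
  smul_mem' := by
    intro c v hv h hh
    rw [map_smul, hv h hh]

lemma isClosed_fixed (ρ : UnitaryRep.{u}) (α : ℕ) : IsClosed (ρ.fixed α : Set ρ.space) := by
  have : (ρ.fixed α : Set ρ.space) = ⋂ h ∈ subK α, {v | ρ.op h v = v} := by
    ext v
    simp only [Set.mem_iInter]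
    rfl
  rw [this]
  exact isClosed_biInter fun h _ => isClosed_eq (ρ.op h).continuous continuous_id

instance (ρ : UnitaryRep.{u}) (α : ℕ) : CompleteSpace (ρ.fixed α) :=
  (ρ.isClosed_fixed α).completeSpace_coe

/-- The operator `P[α] ρ(p)` restricted to `V[β]`, from `V[β]` to `V[α]`. -/
def compress (ρ : UnitaryRep.{u}) (α β : ℕ) (p : finTri) : ρ.fixed β →L[ℂ] ρ.fixed α :=
  ((ρ.fixed α).orthogonalProjectionOnto.comp (ρ.op p : ρ.space →L[ℂ] ρ.space)).comp
    (ρ.fixed β).subtypeL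

/-- The operator `P[α] ρ(p)` restricted to `V[β]` depends only on the double coset of `p`. -/
lemma compress_eq (ρ : UnitaryRep.{u}) (α β : ℕ) {p q : finTri}
    (h : DoubleCoset.setoid (subK α : Set finTri) (subK β) p q) :
    ρ.compress α β p = ρ.compress α β q := by
  obtain ⟨a, ha, b, hb, rfl⟩ := DoubleCoset.rel_iff.mp h
  ext1 v
  have h1 : ρ.op (a * p * b) v = ρ.op a (ρ.op p v) := by
    rw [op_mul, op_mul, v.2 b hb]
  have h2 : ∀ w : ρ.space, (ρ.fixed α).orthogonalProjectionOnto (ρ.op a w)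
      = (ρ.fixed α).orthogonalProjectionOnto w := by
    intro w
    refine ext_inner_left ℂ fun x => ?_
    rw [Submodule.inner_orthogonalProjectionOnto_eq_of_mem_left,
      Submodule.inner_orthogonalProjectionOnto_eq_of_mem_left]
    conv_lhs => rw [← x.2 a ha]
    exact (ρ.op a).inner_map_map _ _
  change (ρ.fixed α).orthogonalProjectionOnto (ρ.op p v)
    = (ρ.fixed α).orthogonalProjectionOnto (ρ.op (a * p * b) v)
  rw [h1, h2]

/-- The family `ρ̄` assigned to a unitary representation `ρ`: the space of the object `α` is `V[α]`,
and the operator of the double coset of `p` is `P[α] ρ(p)` restricted to `V[β]`. -/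
def bar (ρ : UnitaryRep.{u}) : OperatorFamily.{u} where
  space X := ρ.fixed X.level
  map {X Y} f := Quotient.lift (s := DoubleCoset.setoid (subK Y.level : Set finTri) (subK X.level))
    (ρ.compress Y.level X.level) (fun _ _ h => ρ.compress_eq Y.level X.level h) f

end UnitaryRep

end TriSym

end

/-! The theorem is a reconstruction of GNS type. Strong continuity makes the union of the spaces
V[n] total in V (`isTotal_fixed`), so ρ is determined up to equivalence by the inner products of
ρ(h)w and ρ(g)v with w in V[m] and v in V[n]. Every coset of `stabTri n`, the closure of K[n], meets
G (`exists_approx`), and a double coset for these closures meets G in a single double coset of G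
(`cosetMk_eq_of_mul`). Hence the inner product equals ⟨w, ρ̄(c)v⟩, where c is the double coset
`between m n h g` of h⁻¹g. This expression, `OperatorFamily.kernel`, makes sense for any operator
family, and it links the two sides of the correspondence.

Functoriality of ρ̄ rests on `inner_op_diagFin`: matrix elements of Θ_j[β] between vectors fixed by
some K[n] are, for large j, those of P[β]. Indeed P[β]v lies in the closed convex hull of the
K[β]-orbit of v, along that orbit the matrix elements of Θ_j[β] all become one and the same constant
because they depend only on a double coset, and Θ_j[β] fixes P[β]v. Placing Θ_j[β] between p and q
gives `compress_circ`.

Injectivity: equivalent families have equal kernels, and total families of vectors with equal inner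
products differ by a unitary operator (`exists_isometryEquiv`).

Surjectivity: the kernel of a `*`-representation F is positive semi-definite. Finitely many elements
of G are supported in the first N points, where ⊛ becomes the ordinary product
(`circ_mk_of_suppIn`), so the kernel is there a Gram matrix of vectors of F(N) (`exists_gram`). The
resulting Hilbert space carries the unitary action of left translations. Finally, v ↦ 1·v maps F(α)
isometrically onto V[α]: the projection P[α] sends the total family of vectors 1·w into the closed
image of F(α). -/

noncomputable section

namespace TriSym

/-! ### Total families of vectors in Hilbert spaces -/

section Hilbert

variable {X : Type*} {V : Type*} [NormedAddCommGroup V] [InnerProductSpace ℂ V]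
  {W : Type*} [NormedAddCommGroup W] [InnerProductSpace ℂ W]

/-- A family of vectors is total if its linear span is dense. -/
def IsTotal (f : X → V) : Prop := Dense (Submodule.span ℂ (Set.range f) : Set V)

lemma IsTotal.denseRange {f : X → V} (hf : IsTotal f) :
    DenseRange (Finsupp.linearCombination ℂ f) := by
  have h : Set.range (Finsupp.linearCombination ℂ f) = (Submodule.span ℂ (Set.range f) : Set V) := by
    rw [← Finsupp.range_linearCombination, LinearMap.coe_range]
  rw [DenseRange, h]
  exact hf

/-- A closed subspace that contains a total family is everything. -/
lemma IsTotal.mem_of_isClosed {f : X → V} (hf : IsTotal f) (S : Submodule ℂ V)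
    (hS : IsClosed (S : Set V)) (h : ∀ x, f x ∈ S) (v : V) : v ∈ S := by
  have h1 : Submodule.span ℂ (Set.range f) ≤ S :=
    Submodule.span_le.mpr (Set.range_subset_iff.mpr h)
  exact closure_minimal h1 hS (hf v)

lemma IsTotal.ext_inner {f : X → V} (hf : IsTotal f) {v w : V}
    (h : ∀ x, inner ℂ (f x) v = inner ℂ (f x) w) : v = w :=
  Dense.eq_of_inner_right ℂ hf fun u hu => by
    induction hu using Submodule.span_induction with
    | mem u hu => obtain ⟨x, rfl⟩ := hu; exact h x
    | zero => simp
    | add a b _ _ ha hb => rw [inner_add_left, inner_add_left, ha, hb]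
    | smul c a _ ha => rw [inner_smul_left, inner_smul_left, ha]

lemma IsTotal.ext_isometry {f : X → V} (hf : IsTotal f) {S T : V ≃ₗᵢ[ℂ] W}
    (h : ∀ x, S (f x) = T (f x)) (v : V) : S v = T v := by
  refine hf.mem_of_isClosed (LinearMap.eqLocus S.toLinearEquiv.toLinearMap
    T.toLinearEquiv.toLinearMap) ?_ h v
  exact isClosed_eq S.continuous T.continuous

lemma inner_linearCombination (f : X → V) (a b : X →₀ ℂ) :
    inner ℂ (Finsupp.linearCombination ℂ f a) (Finsupp.linearCombination ℂ f b)
      = a.sum fun x z => b.sum fun y w => starRingEnd ℂ z * w * inner ℂ (f x) (f y) := by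
  rw [Finsupp.linearCombination_apply, Finsupp.linearCombination_apply, Finsupp.sum_inner]
  refine Finsupp.sum_congr fun x _ => ?_
  rw [Finsupp.inner_sum]
  refine Finsupp.sum_congr fun y _ => ?_
  rw [inner_smul_left, inner_smul_right, mul_assoc]

/-- Two total families of vectors with the same inner products differ by a unitary operator. -/
lemma exists_isometryEquiv [CompleteSpace V] [CompleteSpace W] {f : X → V} {g : X → W}
    (hf : IsTotal f) (hg : IsTotal g)
    (h : ∀ x y, inner ℂ (f x) (f y) = inner ℂ (g x) (g y)) :
    ∃ U : V ≃ₗᵢ[ℂ] W, ∀ x, U (f x) = g x := by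
  have hn : ∀ a : X →₀ ℂ, ‖Finsupp.linearCombination ℂ g a‖ = ‖Finsupp.linearCombination ℂ f a‖ := by
    intro a
    rw [norm_eq_sqrt_re_inner (𝕜 := ℂ), norm_eq_sqrt_re_inner (𝕜 := ℂ), inner_linearCombination,
      inner_linearCombination]
    simp only [h]
  refine ⟨(LinearEquiv.refl ℂ (X →₀ ℂ)).extendOfIsometry (Finsupp.linearCombination ℂ f)
    (Finsupp.linearCombination ℂ g) hf.denseRange hg.denseRange hn, fun x => ?_⟩
  have := (LinearEquiv.refl ℂ (X →₀ ℂ)).extendOfIsometry_eq (Finsupp.linearCombination ℂ f)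
    (Finsupp.linearCombination ℂ g) hf.denseRange hg.denseRange hn (Finsupp.single x 1)
  simpa using this

/-- The Hilbert completion of a space with a semi-definite inner product. -/
lemma exists_hilbert_completion (E : Type u) [SeminormedAddCommGroup E] [InnerProductSpace ℂ E] :
    ∃ (V : Type u) (_ : NormedAddCommGroup V) (_ : InnerProductSpace ℂ V) (_ : CompleteSpace V)
      (T : E →ₗ[ℂ] V), DenseRange T ∧ ∀ x y, inner ℂ (T x) (T y) = inner ℂ x y :=
  ⟨UniformSpace.Completion E, inferInstance, inferInstance, inferInstance,
    UniformSpace.Completion.toComplₗᵢ.toLinearMap, UniformSpace.Completion.denseRange_coe,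
    fun x y => UniformSpace.Completion.inner_coe x y⟩

/-- A kernel whose restrictions to finite sets are Gram matrices is the kernel of inner products of
a total family of vectors in a Hilbert space. -/
lemma exists_total_of_gram {X : Type u} (K : X → X → ℂ)
    (hK : ∀ s : Finset X, ∃ (E : Type u) (_ : NormedAddCommGroup E) (_ : InnerProductSpace ℂ E)
      (φ : X → E), ∀ x ∈ s, ∀ y ∈ s, K x y = inner ℂ (φ x) (φ y)) :
    ∃ (V : Type u) (_ : NormedAddCommGroup V) (_ : InnerProductSpace ℂ V) (_ : CompleteSpace V)
      (f : X → V), IsTotal f ∧ ∀ x y, inner ℂ (f x) (f y) = K x y := by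
  classical
  have hsymm : ∀ x y, starRingEnd ℂ (K x y) = K y x := by
    intro x y
    obtain ⟨E, _, _, φ, hφ⟩ := hK {x, y}
    rw [hφ x (by simp) y (by simp), hφ y (by simp) x (by simp), inner_conj_symm]
  let core : PreInnerProductSpace.Core ℂ (X →₀ ℂ) :=
    { inner := fun a b => a.sum fun x z => b.sum fun y w => starRingEnd ℂ z * w * K x y
      conj_inner_symm := by
        intro a b
        rw [Finsupp.sum_comm]
        simp only [map_finsuppSum, map_mul, hsymm, Complex.conj_conj]
        refine Finsupp.sum_congr fun x _ => Finsupp.sum_congr fun y _ => ?_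
        ring
      re_inner_nonneg := by
        intro a
        -- Positivity at `a` involves only the points of its support, so one finite Gram matrix
        -- suffices.
        obtain ⟨E, _, _, φ, hφ⟩ := hK a.support
        have : (a.sum fun x z => a.sum fun y w => starRingEnd ℂ z * w * K x y)
            = inner ℂ (Finsupp.linearCombination ℂ φ a) (Finsupp.linearCombination ℂ φ a) := by
          rw [inner_linearCombination]
          refine Finsupp.sum_congr fun x hx => Finsupp.sum_congr fun y hy => ?_
          rw [hφ x hx y hy]
        rw [this]
        exact inner_self_nonneg
      add_left := by
        intro a b c
        rw [Finsupp.sum_add_index'] <;> simp [← Finsupp.sum_add, add_mul]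
      smul_left := by
        intro a b r
        rw [Finsupp.sum_smul_index] <;> simp [Finsupp.mul_sum, ← mul_assoc] }
  let i1 : SeminormedAddCommGroup (X →₀ ℂ) :=
    InnerProductSpace.Core.toSeminormedAddCommGroup (𝕜 := ℂ) (c := core)
  let i2 : InnerProductSpace ℂ (X →₀ ℂ) := InnerProductSpace.ofCore core
  have hinner : ∀ x y : X, i2.inner (Finsupp.single x (1 : ℂ)) (Finsupp.single y (1 : ℂ)) = K x y := by
    intro x y
    change ((Finsupp.single x (1 : ℂ)).sum fun x z => (Finsupp.single y (1 : ℂ)).sum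
      fun y w => starRingEnd ℂ z * w * K x y) = K x y
    simp
  -- The form may be degenerate; the completion also identifies vectors at distance zero.
  obtain ⟨V, j1, j2, j3, T, hT, hTi⟩ := @exists_hilbert_completion (X →₀ ℂ) i1 i2
  refine ⟨V, j1, j2, j3, fun x => T (Finsupp.single x (1 : ℂ)), hT.mono ?_, ?_⟩
  · rintro _ ⟨a, rfl⟩
    rw [SetLike.mem_coe]
    induction a using Finsupp.induction_linear with
    | zero => rw [map_zero]; exact Submodule.zero_mem _
    | add a b ha hb => rw [map_add]; exact Submodule.add_mem _ ha hb
    | single x c =>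
      have : (Finsupp.single x c : X →₀ ℂ) = c • Finsupp.single x 1 := by simp
      rw [this, map_smul]
      exact Submodule.smul_mem _ _ (Submodule.subset_span ⟨x, rfl⟩)
  · intro x y
    rw [hTi]
    exact hinner x y

/-- The closed convex hull of the orbit of a vector under a group of unitary operators contains a
fixed vector. -/
lemma exists_fixed_mem_closure_convexHull [CompleteSpace V] (S : Subgroup (V ≃ₗᵢ[ℂ] V)) (v : V) :
    ∃ u ∈ closure (convexHull ℝ {w | ∃ T ∈ S, T v = w}), ∀ T ∈ S, T u = u := by
  let : InnerProductSpace ℝ V := InnerProductSpace.rclikeToReal ℂ V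
  set O : Set V := {w | ∃ T ∈ S, T v = w} with hO
  have hconv : Convex ℝ (closure (convexHull ℝ O)) := (convex_convexHull ℝ O).closure
  have hne : (closure (convexHull ℝ O)).Nonempty :=
    ⟨v, subset_closure (subset_convexHull ℝ O ⟨1, S.one_mem, rfl⟩)⟩
  -- The fixed vector is the point of least norm of the hull. Each `T` preserves the hull and the
  -- norm, and the variational inequality at `T u` forces `T u = u`.
  obtain ⟨u, hu, hmin⟩ := exists_norm_eq_iInf_of_complete_convex hne isClosed_closure.isComplete
    hconv 0
  rw [norm_eq_iInf_iff_real_inner_le_zero hconv hu] at hmin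
  refine ⟨u, hu, fun T hT => ?_⟩
  have hTO : Set.MapsTo T (closure (convexHull ℝ O)) (closure (convexHull ℝ O)) := by
    refine Set.MapsTo.closure ?_ T.continuous
    have : convexHull ℝ O ⊆ T ⁻¹' convexHull ℝ O := by
      refine convexHull_min ?_ ?_
      · rintro _ ⟨R, hR, rfl⟩
        exact subset_convexHull ℝ O ⟨T * R, S.mul_mem hT hR, rfl⟩
      · exact (convex_convexHull ℝ O).linear_preimage
          (T.toLinearEquiv.toLinearMap.restrictScalars ℝ)
    exact this
  have h1 := hmin (T u) (hTO hu)
  have h2 : ‖T u‖ = ‖u‖ := T.norm_map u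
  have h3 := norm_sub_sq_real (T u) u
  rw [zero_sub, inner_neg_left, inner_sub_right, real_inner_self_eq_norm_sq,
    real_inner_comm] at h1
  have h4 : ‖T u - u‖ ^ 2 ≤ 0 := by rw [h3, h2]; linarith
  have h5 : ‖T u - u‖ = 0 := by nlinarith [norm_nonneg (T u - u)]
  exact sub_eq_zero.mp (norm_eq_zero.mp h5)

end Hilbert

/-! ### Approximation of the tri-symmetric group by its finitely supported elements -/

lemma exists_finPerm_eqOn (k : Equiv.Perm ℕ) (n : ℕ) :
    ∃ h ∈ finPerm, ∀ i < n, h i = k i := by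
  obtain ⟨h, hf, hk⟩ := exists_extension (Finset.range n) k k.injective.injOn
  exact ⟨h, hf, fun i hi => hk i (Finset.mem_range.mpr hi)⟩

lemma stab_anti {m n : ℕ} (h : n ≤ m) : stab m ≤ stab n := fun _ hσ i hi => hσ i (by omega)

/-- The diagonal triples `(k, k, k)` with `k` fixing the first `n` points. -/
def stabTri (n : ℕ) : Subgroup triSym := (stab n).map diagTri

lemma diagTri_mem_stabTri {n : ℕ} {k : Equiv.Perm ℕ} (hk : k ∈ stab n) : diagTri k ∈ stabTri n :=
  ⟨k, hk, rfl⟩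

lemma stabTri_anti {m n : ℕ} (h : n ≤ m) : stabTri m ≤ stabTri n :=
  Subgroup.map_mono (stab_anti h)

lemma finToTri_injective : Function.Injective finToTri :=
  Subgroup.inclusion_injective _

lemma finToTri_diagFin (σ : Equiv.Perm ℕ) (h : σ ∈ finPerm) :
    finToTri (diagFin σ h) = diagTri σ := rfl

lemma mem_subK_iff {n : ℕ} {x : finTri} : x ∈ subK n ↔ finToTri x ∈ stabTri n := by
  constructor
  · intro hx
    obtain ⟨σ, hf, hσ, rfl⟩ := mem_subK.mp hx
    exact ⟨σ, hσ, rfl⟩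
  · rintro ⟨σ, hσ, e⟩
    exact ⟨σ, hσ, congrArg Subtype.val e⟩

/-- An element of `G` supported in the first `n` points commutes with the diagonal elements that
fix these points. -/
lemma SuppIn.commute_stabTri {n : ℕ} {x : finTri} (hx : SuppIn (Finset.range n) x) {d : triSym}
    (hd : d ∈ stabTri n) : finToTri x * d = d * finToTri x := by
  obtain ⟨a, ha, rfl⟩ := hd
  have key : ∀ s : Equiv.Perm ℕ, (∀ y ∉ Finset.range n, s y = y) → s * a = a * s := by
    intro s hs
    have hd : Equiv.Perm.Disjoint s a := by
      intro y
      by_cases hy : y ∈ Finset.range n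
      · exact Or.inr (ha y (Finset.mem_range.mp hy))
      · exact Or.inl (hs y hy)
    exact hd.commute
  apply Subtype.ext
  exact Prod.ext (key _ fun y hy => (hx y hy).1) (Prod.ext (key _ fun y hy => (hx y hy).2.1)
    (key _ fun y hy => (hx y hy).2.2))

/-- The cosets of `stabTri n` in the tri-symmetric group have representatives in `G`. -/
lemma exists_approx (n : ℕ) (g : triSym) : ∃ x : finTri, (finToTri x)⁻¹ * g ∈ stabTri n := by
  obtain ⟨g, hg⟩ := g
  have hmem : g ∈ Subgroup.closure ((diag.range : Set Perm3) ∪ finTri) := by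
    rwa [← Subgroup.sup_eq_closure]
  have hS : ∀ g : Perm3, ∀ hg : g ∈ Subgroup.closure ((diag.range : Set Perm3) ∪ finTri),
      ∃ x ∈ finTri, x⁻¹ * g ∈ (stab n).map diag := by
    have mul : ∀ s ∈ (diag.range : Set Perm3) ∪ finTri, ∀ y : Perm3,
        (∃ x ∈ finTri, x⁻¹ * y ∈ (stab n).map diag) →
        ∃ x ∈ finTri, x⁻¹ * (s * y) ∈ (stab n).map diag := by
      rintro s (⟨k, rfl⟩ | hs) y ⟨x, hx, d, hd, e⟩
      · obtain ⟨N, hN⟩ := exists_suppIn ⟨x, hx⟩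
        -- The finitely supported `h` agrees with `k` on the support of `x` and on the first `n`
        -- points, so `h⁻¹ * k` passes through `x` and joins the factor from `stab n`.
        obtain ⟨h, hf, hk⟩ := exists_finPerm_eqOn k (max N n)
        have hs : h⁻¹ * k ∈ stab (max N n) := fun i hi =>
          Equiv.Perm.inv_eq_iff_eq.mpr (hk i hi).symm
        have hc := congrArg Subtype.val
          ((hN (max N n) (le_max_left _ _)).commute_stabTri (diagTri_mem_stabTri hs))
        change x * diag (h⁻¹ * k) = diag (h⁻¹ * k) * x at hc
        refine ⟨diag h * x, finTri.mul_mem ⟨hf, hf, hf⟩ hx, h⁻¹ * k * d,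
          (stab n).mul_mem (stab_anti (le_max_right _ _) hs) hd, ?_⟩
        have e' : y = x * diag d := by rw [e]; group
        have hc' : diag (h⁻¹ * k) = x⁻¹ * diag (h⁻¹ * k) * x := by
          rw [mul_assoc, ← hc]; group
        rw [map_mul, hc', e', map_mul, map_inv]
        group
      · refine ⟨s * x, finTri.mul_mem hs hx, d, hd, ?_⟩
        rw [e]
        group
    intro g hg
    induction hg using Subgroup.closure_induction_left with
    | one => exact ⟨1, one_mem _, by simp⟩
    | mul_left s hs y _ ih => exact mul s hs y ih
    | inv_mul_cancel s hs y _ ih =>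
      refine mul s⁻¹ ?_ y ih
      rcases hs with hs | hs
      · exact Or.inl (diag.range.inv_mem hs)
      · exact Or.inr (finTri.inv_mem hs)
  obtain ⟨x, hx, d, hd, e⟩ := hS g hmem
  exact ⟨⟨x, hx⟩, d, hd, Subtype.ext e⟩

/-- Two elements of `G` in the same double coset of the tri-symmetric group with respect to the
closures of `K[n]` and `K[m]` are in the same double coset of `G`. -/
lemma cosetMk_eq_of_mul {m n : ℕ} {x y : finTri} {a b : triSym} (ha : a ∈ stabTri m)
    (hb : b ∈ stabTri n) (e : finToTri y = a * finToTri x * b) :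
    cosetMk m n x = cosetMk m n y := by
  obtain ⟨k, hk, rfl⟩ := ha
  obtain ⟨N, hN⟩ := exists_suppIn x
  -- The possibly infinite `k` is replaced by a finitely supported `h`; the error `h⁻¹ * k` commutes
  -- with `x` and is absorbed into `b`.
  obtain ⟨h, hf, hh⟩ := exists_finPerm_eqOn k (max N (max m n))
  have hs : h⁻¹ * k ∈ stab (max N (max m n)) := fun i hi =>
    Equiv.Perm.inv_eq_iff_eq.mpr (hh i hi).symm
  have hc := (hN (max N (max m n)) (le_max_left _ _)).commute_stabTri (diagTri_mem_stabTri hs)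
  have hm : diagFin h hf ∈ subK m :=
    mem_subK.mpr ⟨h, hf, fun i hi => by rw [hh i (by omega), hk i hi], rfl⟩
  rw [DoubleCoset.eq]
  refine ⟨diagFin h hf, hm, (diagFin h hf * x)⁻¹ * y, ?_, by group⟩
  rw [mem_subK_iff]
  have e2 : finToTri ((diagFin h hf * x)⁻¹ * y) = diagTri (h⁻¹ * k) * b := by
    rw [map_mul, map_inv, map_mul, finToTri_diagFin, e]
    have hc' : diagTri (h⁻¹ * k) = (finToTri x)⁻¹ * diagTri (h⁻¹ * k) * finToTri x := by
      rw [mul_assoc, ← hc]; group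
    rw [hc', map_mul, map_inv]
    group
  rw [e2]
  exact mul_mem (stabTri_anti (by omega) (diagTri_mem_stabTri hs)) hb

/-- An element of `G` in the coset of `g` with respect to `stabTri n`. -/
def approx (n : ℕ) (g : triSym) : finTri := (exists_approx n g).choose

lemma approx_spec (n : ℕ) (g : triSym) : (finToTri (approx n g))⁻¹ * g ∈ stabTri n :=
  (exists_approx n g).choose_spec

/-- The double coset of `h⁻¹ * g` with respect to the closures of `K[m]` and `K[n]`. -/
def between (m n : ℕ) (h g : triSym) : Cosets m n := cosetMk m n ((approx m h)⁻¹ * approx n g)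

/-- Independence of the chosen representatives: two representatives of one coset differ by an
element of `stabTri`, which `cosetMk_eq_of_mul` ignores. -/
lemma between_eq {m n : ℕ} {h g : triSym} {x y : finTri} (hy : (finToTri y)⁻¹ * h ∈ stabTri m)
    (hx : (finToTri x)⁻¹ * g ∈ stabTri n) : between m n h g = cosetMk m n (y⁻¹ * x) := by
  refine cosetMk_eq_of_mul (a := (finToTri y)⁻¹ * h * ((finToTri (approx m h))⁻¹ * h)⁻¹)
    (b := (finToTri (approx n g))⁻¹ * g * ((finToTri x)⁻¹ * g)⁻¹)
    (mul_mem hy (inv_mem (approx_spec m h))) (mul_mem (approx_spec n g) (inv_mem hx)) ?_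
  simp only [map_mul, map_inv]
  group

lemma between_finToTri (m n : ℕ) (x y : finTri) :
    between m n (finToTri y) (finToTri x) = cosetMk m n (y⁻¹ * x) :=
  between_eq (by simp) (by simp)

lemma between_mul_left (m n : ℕ) (t h g : triSym) :
    between m n (t * h) (t * g) = between m n h g := by
  refine (cosetMk_eq_of_mul (a := (finToTri (approx m (t * h)))⁻¹ * (t * h) *
      ((finToTri (approx m h))⁻¹ * h)⁻¹)
    (b := (finToTri (approx n g))⁻¹ * g * ((finToTri (approx n (t * g)))⁻¹ * (t * g))⁻¹)
    (mul_mem (approx_spec _ _) (inv_mem (approx_spec _ _)))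
    (mul_mem (approx_spec _ _) (inv_mem (approx_spec _ _))) ?_).symm
  simp only [map_mul, map_inv]
  group

lemma between_mul_right {m n : ℕ} (h g : triSym) {d : triSym} (hd : d ∈ stabTri n) :
    between m n h (g * d) = between m n h g := by
  refine between_eq (approx_spec m h) ?_
  rw [← mul_assoc]
  exact mul_mem (approx_spec n g) hd

/-! ### Continuity -/

lemma nhds_permTopology (k : Equiv.Perm ℕ) :
    (@nhds _ permTopology k).HasBasis (fun _ : ℕ => True) fun n => {h | ∀ i < n, h i = k i} := by
  let := permTopology
  constructor
  intro t
  have hind : 𝓝 k = Filter.comap (fun σ : Equiv.Perm ℕ => (σ : ℕ → ℕ)) (𝓝 (k : ℕ → ℕ)) :=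
    nhds_induced _ _
  rw [hind, nhds_pi, Filter.mem_comap]
  simp only [nhds_discrete, true_and]
  constructor
  · rintro ⟨u, hu, hut⟩
    rw [Filter.mem_pi] at hu
    obtain ⟨I, hI, s, hs, hsu⟩ := hu
    obtain ⟨N, hN⟩ := hI.bddAbove
    refine ⟨N + 1, fun h hh => hut (hsu fun i hi => ?_)⟩
    have hi' : h i = k i := hh i (Nat.lt_succ_of_le (hN hi))
    change h i ∈ s i
    rw [hi']
    exact hs i
  · rintro ⟨n, hn⟩
    refine ⟨Set.pi (Set.Iio n) fun i => {k i}, ?_, fun h hh => hn fun i hi => hh i hi⟩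
    exact Filter.pi_mem_pi (Set.finite_Iio n) fun i _ => by simp

lemma continuous_triTopology {Y : Type*} [TopologicalSpace Y] {f : triSym → Y} :
    Continuous[triTopology, inferInstance] f ↔
      ∀ g, Continuous[permTopology, inferInstance] fun k => f (g * diagTri k) := by
  rw [triTopology, continuous_iSup_dom]
  refine forall_congr' fun g => ?_
  rw [continuous_coinduced_dom]
  rfl

/-- A function on the full symmetric group is continuous if its value at `h` is its value at `k` for
all `h` that agree with `k` on a suitable finite set. -/
lemma continuous_permTopology_of_eq {Y : Type*} [TopologicalSpace Y] {f : Equiv.Perm ℕ → Y}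
    (H : ∀ k, ∃ n, ∀ h : Equiv.Perm ℕ, (∀ i < n, h i = k i) → f h = f k) :
    Continuous[permTopology, inferInstance] f := by
  let := permTopology
  refine continuous_iff_continuousAt.mpr fun k => ?_
  obtain ⟨n, hn⟩ := H k
  refine tendsto_nhds_of_eventually_eq ?_
  exact ((nhds_permTopology k).eventually_iff).mpr ⟨n, trivial, fun h hh => hn h hh⟩

/-! ### The family assigned to a unitary representation -/

namespace UnitaryRep

variable (ρ : UnitaryRep.{u})

lemma rho_mul (g h : triSym) (v : ρ.space) : ρ.rho (g * h) v = ρ.rho g (ρ.rho h v) := by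
  rw [map_mul]
  rfl

lemma rho_one (v : ρ.space) : ρ.rho 1 v = v := by
  rw [map_one]
  rfl

lemma inner_rho (g h : triSym) (v w : ρ.space) :
    inner ℂ (ρ.rho h w) (ρ.rho g v) = inner ℂ w (ρ.rho (h⁻¹ * g) v) := by
  rw [rho_mul, ← (ρ.rho h).inner_map_map w, ← rho_mul ρ h, mul_inv_cancel, rho_one]

lemma inner_op (x y : finTri) (v w : ρ.space) :
    inner ℂ (ρ.op y w) (ρ.op x v) = inner ℂ w (ρ.op (y⁻¹ * x) v) := by
  rw [op, op, inner_rho, op, map_mul finToTri, map_inv finToTri]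

lemma fixed_mono {m n : ℕ} (h : m ≤ n) : ρ.fixed m ≤ ρ.fixed n := by
  intro v hv x hx
  rw [mem_subK_iff] at hx
  exact hv x (mem_subK_iff.mpr (stabTri_anti h hx))

lemma op_mem_fixed {n : ℕ} {x : finTri} (hx : SuppIn (Finset.range n) x) {v : ρ.space}
    (hv : v ∈ ρ.fixed n) : ρ.op x v ∈ ρ.fixed n := by
  intro h hh
  have hc : x * h = h * x := finToTri_injective (by
    rw [map_mul, map_mul]
    exact hx.commute_stabTri (mem_subK_iff.mp hh))
  rw [← op_mul, ← hc, op_mul, hv h hh]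

lemma continuous_rho_diagTri (g : triSym) (v : ρ.space) :
    Continuous[permTopology, inferInstance] fun k => ρ.rho (g * diagTri k) v :=
  continuous_triTopology.mp (ρ.strongly_continuous v) g

lemma exists_norm_sub_lt (k : Equiv.Perm ℕ) (v : ρ.space) {ε : ℝ} (hε : 0 < ε) :
    ∃ n, ∀ h : Equiv.Perm ℕ, (∀ i < n, h i = k i) →
      ‖ρ.rho (diagTri h) v - ρ.rho (diagTri k) v‖ < ε := by
  let := permTopology
  have h1 := (ρ.continuous_rho_diagTri 1 v).tendsto k
  have h2 := Metric.tendsto_nhds.mp h1 ε hε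
  obtain ⟨n, -, hn⟩ := ((nhds_permTopology k).eventually_iff).mp h2
  refine ⟨n, fun h hh => ?_⟩
  have := hn (x := h) hh
  simpa [dist_eq_norm] using this

/-- Finitely supported permutations are dense in `stab n`, so invariance under K[n] passes to its
closure by strong continuity. -/
lemma rho_of_mem_stabTri {n : ℕ} {d : triSym} (hd : d ∈ stabTri n) {v : ρ.space}
    (hv : v ∈ ρ.fixed n) : ρ.rho d v = v := by
  obtain ⟨k, hk, rfl⟩ := hd
  refine eq_of_forall_dist_le fun ε hε => ?_
  obtain ⟨N, hN⟩ := ρ.exists_norm_sub_lt k v hε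
  obtain ⟨h, hf, hh⟩ := exists_finPerm_eqOn k (max N n)
  have h1 := hN h fun i hi => hh i (by omega)
  have h2 : ρ.rho (diagTri h) v = v := hv (diagFin h hf)
    (mem_subK.mpr ⟨h, hf, fun i hi => by rw [hh i (by omega), hk i hi], rfl⟩)
  rw [h2] at h1
  rw [dist_comm, dist_eq_norm]
  exact h1.le

lemma rho_eq_op {n : ℕ} {g : triSym} {x : finTri} (hx : (finToTri x)⁻¹ * g ∈ stabTri n)
    {v : ρ.space} (hv : v ∈ ρ.fixed n) : ρ.rho g v = ρ.op x v := by
  have h := ρ.rho_of_mem_stabTri hx hv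
  conv_rhs => rw [← h]
  rw [op, ← rho_mul, mul_inv_cancel_left]

/-- The projection of a vector to the space of `K[α]`-fixed vectors is in the closed convex hull of
its orbit. -/
lemma starProjection_mem_closure_convexHull (α : ℕ) (v : ρ.space) :
    (ρ.fixed α).starProjection v ∈ closure (convexHull ℝ {w | ∃ h ∈ subK α, ρ.op h v = w}) := by
  obtain ⟨u, hu, hfix⟩ := exists_fixed_mem_closure_convexHull
    ((subK α).map (ρ.rho.comp finToTri)) v
  have hO : {w | ∃ T ∈ (subK α).map (ρ.rho.comp finToTri), T v = w}
      = {w | ∃ h ∈ subK α, ρ.op h v = w} := by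
    ext w
    constructor
    · rintro ⟨_, ⟨h, hh, rfl⟩, e⟩
      exact ⟨h, hh, e⟩
    · rintro ⟨h, hh, e⟩
      exact ⟨_, ⟨h, hh, rfl⟩, e⟩
  rw [hO] at hu
  have hu' : u ∈ ρ.fixed α := fun h hh => hfix _ ⟨h, hh, rfl⟩
  suffices h : (ρ.fixed α).starProjection v = u by rwa [h]
  refine Submodule.eq_starProjection_of_mem_of_inner_eq_zero hu' fun w hw => ?_
  -- For fixed `w` this condition is closed, convex and true on the orbit of `v`, hence true at `u`;
  -- so `v - u` is orthogonal to the fixed vectors.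
  have hcl : IsClosed {x : ρ.space | inner ℂ (v - x) w = 0} :=
    isClosed_eq (by fun_prop) continuous_const
  have hcv : Convex ℝ {x : ρ.space | inner ℂ (v - x) w = 0} := by
    intro x hx y hy a b ha hb hab
    simp only [Set.mem_ofPred_eq] at hx hy ⊢
    have e : v - (a • x + b • y) = a • (v - x) + b • (v - y) := by
      rw [smul_sub, smul_sub, sub_add_sub_comm, ← add_smul, hab, one_smul]
    have e1 : ∀ (c : ℝ) (z : ρ.space), c • z = (c : ℂ) • z := fun c z => rfl
    rw [e, e1, e1, inner_add_left, inner_smul_left, inner_smul_left, hx, hy]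
    simp
  refine closure_minimal (convexHull_min ?_ hcv) hcl hu
  rintro _ ⟨h, hh, rfl⟩
  have : inner ℂ (ρ.op h v) w = inner ℂ v w := by
    conv_lhs => rw [← hw h hh]
    exact (ρ.op h).inner_map_map v w
  simp [this]

/-- Every vector is approximated by vectors fixed by a group `K[n]`. -/
lemma exists_starProjection_near (v : ρ.space) {ε : ℝ} (hε : 0 < ε) :
    ∃ n, dist ((ρ.fixed n).starProjection v) v ≤ ε := by
  obtain ⟨n, hn⟩ := ρ.exists_norm_sub_lt 1 v hε
  refine ⟨n, ?_⟩
  -- For this `n` the group K[n] moves `v` by less than `ε`, and a closed ball is closed and convex,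
  -- so it contains the projection of `v` as well.
  have : closure (convexHull ℝ {w | ∃ h ∈ subK n, ρ.op h v = w}) ⊆ Metric.closedBall v ε := by
    refine closure_minimal (convexHull_min ?_ (convex_closedBall v ε)) Metric.isClosed_closedBall
    rintro _ ⟨h, hh, rfl⟩
    obtain ⟨σ, hf, hσ, rfl⟩ := mem_subK.mp hh
    have h1 := hn σ fun i hi => hσ i hi
    rw [map_one, rho_one] at h1
    rw [Metric.mem_closedBall, dist_eq_norm]
    exact h1.le
  exact this (ρ.starProjection_mem_closure_convexHull n v)

lemma isTotal_fixed : IsTotal fun a : Σ n, ρ.fixed n => (a.2 : ρ.space) := by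
  intro v
  refine Metric.mem_closure_iff.mpr fun ε hε => ?_
  obtain ⟨n, hn⟩ := ρ.exists_starProjection_near v (half_pos hε)
  refine ⟨_, Submodule.subset_span ⟨⟨n, ⟨_, Submodule.starProjection_apply_mem _ v⟩⟩, rfl⟩, ?_⟩
  rw [dist_comm]
  change dist ((ρ.fixed n).starProjection v) v < ε
  linarith

lemma inner_compress {α β : ℕ} (p : finTri) (v : ρ.fixed β) (w : ρ.fixed α) :
    inner ℂ w (ρ.compress α β p v) = inner ℂ (w : ρ.space) (ρ.op p v) :=
  Submodule.inner_orthogonalProjectionOnto_eq_of_mem_left w _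

lemma inner_op_eq {m n : ℕ} {x y : finTri} (h : cosetMk m n x = cosetMk m n y) {v w : ρ.space}
    (hv : v ∈ ρ.fixed n) (hw : w ∈ ρ.fixed m) : inner ℂ w (ρ.op x v) = inner ℂ w (ρ.op y v) := by
  have h1 := ρ.inner_compress x ⟨v, hv⟩ ⟨w, hw⟩
  have h2 := ρ.inner_compress y ⟨v, hv⟩ ⟨w, hw⟩
  rw [← ρ.compress_eq m n (Quotient.exact h), h1] at h2
  exact h2

lemma op_fixed_one (v : ρ.space) : ρ.op 1 v = v := by
  rw [op, map_one, rho_one]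

/-- Matrix elements of the diagonal elements that move the points far away. -/
lemma inner_op_diagFin {β m n : ℕ} {σ : Equiv.Perm ℕ} (hσ : σ ∈ finPerm)
    (sσ : Separates β (Finset.range n) (Finset.range m) σ) {v w : ρ.space}
    (hv : v ∈ ρ.fixed n) (hw : w ∈ ρ.fixed m) :
    inner ℂ w (ρ.op (diagFin σ hσ) v) = inner ℂ w ((ρ.fixed β).starProjection v) := by
  -- The matrix element against `w` is eventually the constant attached to `σ`. This holds on the
  -- K[β]-orbit of `v` and survives convex combinations, but not closure, whence the final estimate.
  let C : Set ρ.space := {c | ∀ᶠ j in atTop,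
    inner ℂ w (ρ.op (Theta β j) c) = inner ℂ w (ρ.op (diagFin σ hσ) v)}
  have hC : convexHull ℝ {c | ∃ h ∈ subK β, ρ.op h v = c} ⊆ C := by
    refine convexHull_min ?_ ?_
    · rintro _ ⟨h, hh, rfl⟩
      obtain ⟨κ, hκ, hκβ, rfl⟩ := mem_subK.mp hh
      -- For such `j ≥ m`, a point of `κ (range n)` that is at least `β` goes to `κ x + j ≥ m`. Thus
      -- `thetaPerm β j * κ` separates like `σ` and has the same double coset.
      have hfin : ∀ᶠ j in atTop, ∀ x ∈ Finset.range n, κ x < j := by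
        rw [Filter.eventually_all_finset]
        exact fun x _ => eventually_gt_atTop (κ x)
      filter_upwards [hfin, eventually_ge_atTop m] with j hj hm
      rw [← op_mul]
      have hθ := finPerm.mul_mem (thetaPerm_mem β j) hκ
      have s1 : Separates β (Finset.range n) (Finset.range m) (thetaPerm β j * κ) := by
        constructor
        · intro i hi
          rw [Equiv.Perm.mul_apply, hκβ i hi, thetaPerm_apply, if_pos hi]
        · intro x hx hy
          have h1 := hj x hx
          rw [Finset.mem_range, Equiv.Perm.mul_apply, thetaPerm_apply] at hy
          have h2 : κ x < β := by
            split_ifs at hy <;> omega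
          have h3 := κ.injective (hκβ _ h2)
          omega
      have sp : ∀ k, SuppIn (Finset.range k) 1 := fun k x _ => ⟨rfl, rfl, rfl⟩
      have e := coset_eq_of_separates (α := m) (γ := n) (sp m) (sp n) subset_rfl subset_rfl hθ hσ
        s1 sσ
      rw [one_mul, mul_one, one_mul, mul_one] at e
      exact ρ.inner_op_eq e hv hw
    · intro x hx y hy a b ha hb hab
      filter_upwards [hx, hy] with j h1 h2
      have e1 : ∀ (c : ℝ) (z : ρ.space), c • z = (c : ℂ) • z := fun c z => rfl
      rw [e1, e1, map_add, map_smul, map_smul, inner_add_right, inner_smul_right, inner_smul_right,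
        h1, h2, ← add_mul, ← Complex.ofReal_add, hab, Complex.ofReal_one, one_mul]
  have hu := ρ.starProjection_mem_closure_convexHull β v
  set u := (ρ.fixed β).starProjection v with hu_def
  have hfix : u ∈ ρ.fixed β := Submodule.starProjection_apply_mem _ v
  refine eq_of_forall_dist_le fun ε hε => ?_
  -- The added 1 covers `w = 0`.
  have hw0 : 0 < ‖w‖ + 1 := by positivity
  obtain ⟨c, hc, hd⟩ := Metric.mem_closure_iff.mp hu (ε / (‖w‖ + 1)) (div_pos hε hw0)
  obtain ⟨j, hj⟩ := (hC hc).exists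
  have hΘ : ρ.op (Theta β j) u = u := hfix _
    (mem_subK.mpr ⟨_, thetaPerm_mem β j, (separates_theta (le_refl j)).1, rfl⟩)
  rw [← hj, ← hΘ, dist_comm, dist_eq_norm, ← inner_sub_right, ← map_sub]
  refine (norm_inner_le_norm _ _).trans ?_
  rw [LinearIsometryEquiv.norm_map, ← dist_eq_norm]
  rw [lt_div_iff₀ hw0] at hd
  nlinarith [norm_nonneg w, dist_nonneg (x := u) (y := c)]

/-- The product is represented by p Θ_N[β] q with N beyond the supports of p and q. Then ρ(q)v and
ρ(p⁻¹)w are fixed by K[N], and between such vectors Θ_N[β] acts as P[β]. -/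
lemma compress_circ {α β γ : ℕ} (p q : finTri) {r : finTri}
    (hr : cosetMk α γ r = circ (cosetMk α β p) (cosetMk β γ q)) :
    ρ.compress α γ r = (ρ.compress α β p).comp (ρ.compress β γ q) := by
  obtain ⟨N₁, hN₁⟩ := exists_suppIn p
  obtain ⟨N₂, hN₂⟩ := exists_suppIn q
  obtain ⟨N, hN⟩ : ∃ N, N = N₁ + N₂ + α + γ := ⟨_, rfl⟩
  have sp := hN₁ N (by omega)
  have sq := hN₂ N (by omega)
  have sθ := separates_theta (β := β) (le_refl N)
  rw [circ_mk sp sq (Finset.range_mono (by omega)) (Finset.range_mono (by omega))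
    (thetaPerm_mem β N) sθ] at hr
  rw [ρ.compress_eq α γ (Quotient.exact hr)]
  ext1 v
  refine ext_inner_left ℂ fun w => ?_
  have hv : ρ.op q v ∈ ρ.fixed N := ρ.op_mem_fixed sq (ρ.fixed_mono (by omega) v.2)
  have hw : ρ.op p⁻¹ w ∈ ρ.fixed N := by
    refine ρ.op_mem_fixed (fun x hx => ?_) (ρ.fixed_mono (by omega) w.2)
    obtain ⟨h1, h2, h3⟩ := sp x hx
    exact ⟨Equiv.Perm.inv_eq_iff_eq.mpr h1.symm, Equiv.Perm.inv_eq_iff_eq.mpr h2.symm,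
      Equiv.Perm.inv_eq_iff_eq.mpr h3.symm⟩
  have hp : ∀ u : ρ.space, inner ℂ (w : ρ.space) (ρ.op p u) = inner ℂ (ρ.op p⁻¹ w) u := by
    intro u
    rw [← (ρ.op p⁻¹).inner_map_map (w : ρ.space), op_inv_op]
  rw [inner_compress, op_mul, op_mul, hp, ρ.inner_op_diagFin _ sθ hv hw]
  change _ = inner ℂ w (ρ.compress α β p (ρ.compress β γ q v))
  rw [inner_compress, hp]
  rfl

lemma bar_isStarRep : ρ.bar.IsStarRep where
  map_id X := by
    change ρ.compress X.level X.level 1 = ContinuousLinearMap.id ℂ (ρ.fixed X.level)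
    ext1 v
    refine ext_inner_left ℂ fun w => ?_
    rw [inner_compress, op_fixed_one]
    rfl
  map_comp {X Y Z} f g := by
    obtain ⟨p, rfl⟩ : ∃ p, cosetMk _ _ p = f := ⟨_, DoubleCoset.out_eq' _ _ f⟩
    obtain ⟨q, rfl⟩ : ∃ q, cosetMk _ _ q = g := ⟨_, DoubleCoset.out_eq' _ _ g⟩
    obtain ⟨r, hr⟩ : ∃ r, cosetMk Z.level X.level r =
        circ (cosetMk Z.level Y.level q) (cosetMk Y.level X.level p) :=
      ⟨_, DoubleCoset.out_eq' _ _ _⟩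
    have h := ρ.compress_circ q p hr
    change ρ.bar.map (circ (cosetMk _ _ q) (cosetMk _ _ p)) = _
    rw [← hr]
    exact h
  map_star {X Y} f := by
    obtain ⟨p, rfl⟩ : ∃ p, cosetMk _ _ p = f := ⟨_, DoubleCoset.out_eq' _ _ f⟩
    change ρ.compress X.level Y.level p⁻¹
      = ContinuousLinearMap.adjoint (ρ.compress Y.level X.level p)
    rw [ContinuousLinearMap.eq_adjoint_iff]
    intro v w
    rw [inner_compress, ← inner_conj_symm, inner_compress, inner_conj_symm,
      ← (ρ.op p).inner_map_map, ← op_mul, mul_inv_cancel, op_fixed_one]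

end UnitaryRep

/-! ### Matrix elements -/

namespace OperatorFamily

variable (F : OperatorFamily.{u})

/-- Formal vectors `g · v`, where `g` is an element of the tri-symmetric group and `v` is an element
of one of the spaces of the family. -/
abbrev Vec : Type u := triSym × Σ X : ObjK, F.space X

/-- The inner product of `h · w` and `g · v`. -/
def kernel (a b : F.Vec) : ℂ :=
  inner ℂ a.2.2 (F.map (X := b.2.1) (Y := a.2.1) (between a.2.1.level b.2.1.level a.1 b.1) b.2.2)

lemma kernel_translate (t : triSym) (a b : F.Vec) :
    F.kernel (t * a.1, a.2) (t * b.1, b.2) = F.kernel a b := by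
  simp only [kernel, between_mul_left]

end OperatorFamily

/-! ### Injectivity: a unitary representation is recovered from its family -/

namespace UnitaryRep

variable (ρ : UnitaryRep.{u})

/-- The vector `ρ(g) v` of a formal vector `g · v`. -/
def vec (a : ρ.bar.Vec) : ρ.space := ρ.rho a.1 (Subtype.val (p := (· ∈ ρ.fixed a.2.1.level)) a.2.2)

lemma inner_vec (a b : ρ.bar.Vec) : inner ℂ (ρ.vec a) (ρ.vec b) = ρ.bar.kernel a b := by
  obtain ⟨h, Y, w⟩ := a
  obtain ⟨g, X, v⟩ := b
  have hv : Subtype.val (p := (· ∈ ρ.fixed X.level)) v ∈ ρ.fixed X.level := v.2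
  have hw : Subtype.val (p := (· ∈ ρ.fixed Y.level)) w ∈ ρ.fixed Y.level := w.2
  change inner ℂ (ρ.rho h (Subtype.val (p := (· ∈ ρ.fixed Y.level)) w))
    (ρ.rho g (Subtype.val (p := (· ∈ ρ.fixed X.level)) v)) = _
  rw [ρ.rho_eq_op (approx_spec _ h) hw, ρ.rho_eq_op (approx_spec _ g) hv, inner_op]
  exact (ρ.inner_compress ((approx Y.level h)⁻¹ * approx X.level g) v w).symm

lemma isTotal_vec : IsTotal ρ.vec := by
  refine ρ.isTotal_fixed.mono (Submodule.span_mono ?_)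
  rintro _ ⟨⟨n, v⟩, rfl⟩
  exact ⟨(1, ⟨⟨n⟩, v⟩), ρ.rho_one v⟩

lemma rho_vec (g : triSym) (a : ρ.bar.Vec) : ρ.rho g (ρ.vec a) = ρ.vec (g * a.1, a.2) :=
  (ρ.rho_mul g a.1 _).symm

/-- The `*`-representation of `𝒦` assigned to a unitary representation. -/
def barRep : StarRep.{u} := ⟨ρ.bar, ρ.bar_isStarRep⟩

variable {ρ} {π : UnitaryRep.{u}}

/-- Equivalent unitary representations have equivalent families. -/
lemma bar_equiv (h : ρ ≈ π) : ρ.barRep ≈ π.barRep := by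
  obtain ⟨U, hU⟩ := h
  have hop : ∀ (x : finTri) (v : ρ.space), U (ρ.op x v) = π.op x (U v) := fun x v => hU _ v
  have hfix : ∀ (n : ℕ) (v : ρ.space), v ∈ ρ.fixed n ↔ U v ∈ π.fixed n := by
    intro n v
    refine forall_congr' fun x => forall_congr' fun _ => ?_
    rw [← hop, U.injective.eq_iff]
  -- An intertwiner carries fixed spaces onto fixed spaces; its restrictions are the required
  -- unitaries.
  have hmap : ∀ n, (ρ.fixed n).map U.toLinearEquiv.toLinearMap = π.fixed n := by
    intro n
    ext w
    constructor
    · rintro ⟨v, hv, rfl⟩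
      exact (hfix n v).mp hv
    · intro hw
      refine ⟨U.symm w, (hfix n _).mpr ?_, U.apply_symm_apply w⟩
      rwa [U.apply_symm_apply]
  let T : ∀ n, ρ.fixed n ≃ₗᵢ[ℂ] π.fixed n := fun n =>
    { toLinearEquiv := U.toLinearEquiv.ofSubmodules _ _ (hmap n)
      norm_map' := fun v => U.norm_map v }
  have hT : ∀ n (v : ρ.fixed n), (T n v : π.space) = U v := fun _ _ => rfl
  refine ⟨fun X => T X.level, fun X Y f => ?_⟩
  obtain ⟨p, rfl⟩ : ∃ p, cosetMk _ _ p = f := ⟨_, DoubleCoset.out_eq' _ _ f⟩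
  change ∀ v : ρ.fixed X.level, T Y.level (ρ.compress Y.level X.level p v)
    = π.compress Y.level X.level p (T X.level v)
  intro v
  refine ext_inner_left ℂ fun w => ?_
  obtain ⟨w, rfl⟩ := (T Y.level).surjective w
  rw [(T Y.level).inner_map_map, inner_compress, inner_compress, hT, hT, ← hop, U.inner_map_map]

/-- Unitary representations with equivalent families are equivalent. -/
lemma equiv_of_bar_equiv (h : ρ.barRep ≈ π.barRep) : ρ ≈ π := by
  obtain ⟨T, hT⟩ : ∃ T : ∀ X, ρ.bar.space X ≃ₗᵢ[ℂ] π.bar.space X,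
    ∀ (X Y : ObjK) (f : X ⟶ Y) (v : ρ.bar.space X), T Y (ρ.bar.map f v) = π.bar.map f (T X v) := h
  -- The two families ρ(g)v and π(g)(T v), indexed by the same formal vectors, have the same inner
  -- products because `T` intertwines the families.
  let f : ρ.bar.Vec → π.space := fun a => π.vec (a.1, ⟨a.2.1, T a.2.1 a.2.2⟩)
  have hf : IsTotal f := by
    refine π.isTotal_vec.mono (Submodule.span_mono ?_)
    rintro _ ⟨⟨g, X, v⟩, rfl⟩
    exact ⟨(g, ⟨X, (T X).symm v⟩), by simp only [f, LinearIsometryEquiv.apply_symm_apply]⟩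
  obtain ⟨U, hU⟩ := exists_isometryEquiv ρ.isTotal_vec hf (by
    intro a b
    rw [inner_vec, inner_vec]
    simp only [OperatorFamily.kernel]
    rw [← hT, (T a.2.1).inner_map_map])
  refine ⟨U, fun g v => ?_⟩
  refine ρ.isTotal_vec.ext_isometry (S := (ρ.rho g).trans U) (T := U.trans (π.rho g))
    (fun a => ?_) v
  change U (ρ.rho g (ρ.vec a)) = π.rho g (U (ρ.vec a))
  rw [rho_vec, hU, hU, rho_vec]

end UnitaryRep

/-! ### The unitary representation of a `*`-representation -/

/-- When `x` lives on the first `β` points there is nothing to move away: the identity already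
separates, so ⊛ is the ordinary product. -/
lemma circ_mk_of_suppIn {α β γ : ℕ} (p : finTri) {x : finTri} (hx : SuppIn (Finset.range β) x)
    (hγ : γ ≤ β) : circ (cosetMk α β p) (cosetMk β γ x) = cosetMk α γ (p * x) := by
  obtain ⟨N, hN⟩ := exists_suppIn p
  have h := circ_mk (α := α) (β := β) (γ := γ) (hN (max N α) (le_max_left _ _)) hx
    (Finset.range_mono (le_max_right _ _)) (Finset.range_mono hγ) (σ := 1) (one_mem _)
    ⟨fun _ _ => rfl, fun y hy _ => Finset.mem_range.mp hy⟩
  have e : diagFin 1 (one_mem _) = 1 := rfl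
  rwa [e, mul_one] at h

namespace OperatorFamily

namespace IsStarRep

variable {F : OperatorFamily.{u}}

lemma map_circ (hF : F.IsStarRep) {X Y Z : ObjK} (P : Cosets X.level Y.level)
    (Q : Cosets Y.level Z.level) (v : F.space Z) : F.map (X := Z) (Y := X) (circ P Q) v
      = F.map (X := Y) (Y := X) P (F.map (X := Z) (Y := Y) Q v) := by
  have h := hF.map_comp (X := Z) (Y := Y) (Z := X) Q P
  exact DFunLike.congr_fun h v

lemma map_one (hF : F.IsStarRep) (X : ObjK) (v : F.space X) :
    F.map (X := X) (Y := X) (cosetMk X.level X.level 1) v = v :=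
  DFunLike.congr_fun (hF.map_id X) v

lemma inner_map (hF : F.IsStarRep) {X Y : ObjK} (p : finTri) (v : F.space X) (w : F.space Y) :
    inner ℂ (F.map (X := Y) (Y := X) (cosetMk X.level Y.level p) w) v
      = inner ℂ w (F.map (X := X) (Y := Y) (cosetMk Y.level X.level p⁻¹) v) := by
  have h := hF.map_star (X := Y) (Y := X) (cosetMk X.level Y.level p)
  change F.map (X := X) (Y := Y) (cosetMk Y.level X.level p⁻¹) = _ at h
  rw [h, ContinuousLinearMap.adjoint_inner_right]

/-- The kernel of a `*`-representation is locally a kernel of inner products. -/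
lemma exists_gram (hF : F.IsStarRep) (s : Finset F.Vec) :
    ∃ (E : Type u) (_ : NormedAddCommGroup E) (_ : InnerProductSpace ℂ E)
      (φ : F.Vec → E), ∀ a ∈ s, ∀ b ∈ s, F.kernel a b = inner ℂ (φ a) (φ b) := by
  choose B hB using exists_suppIn
  let x : F.Vec → finTri := fun a => approx a.2.1.level a.1
  -- One object `N` serves all of `s`: every representative is supported in the first `N` points and
  -- every level is at most `N`.
  let N := s.sup fun a => max (B (x a)) a.2.1.level
  have hN : ∀ a ∈ s, max (B (x a)) a.2.1.level ≤ N := fun a ha =>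
    Finset.le_sup (f := fun a => max (B (x a)) a.2.1.level) ha
  refine ⟨F.space ⟨N⟩, inferInstance, inferInstance,
    fun a => F.map (X := a.2.1) (Y := ⟨N⟩) (cosetMk N a.2.1.level (x a)) a.2.2, ?_⟩
  intro a ha b hb
  have h1 := hN a ha
  have h2 := hN b hb
  have hc := circ_mk_of_suppIn (α := a.2.1.level) (x a)⁻¹ (hB (x b) N (by omega))
    (γ := b.2.1.level) (by omega)
  rw [hF.inner_map (X := ⟨N⟩), ← hF.map_circ (Y := ⟨N⟩), hc]
  rfl

/-! ### Total families of vectors that realize the kernel -/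

section Model

variable {V : Type u} [NormedAddCommGroup V] [InnerProductSpace ℂ V] {f : F.Vec → V}

/-- Relations between formal vectors are not imposed by a quotient; they hold in the model as soon
as the kernel cannot tell the two sides apart. -/
lemma vec_eq (hf : IsTotal f) (hK : ∀ a b, inner ℂ (f a) (f b) = F.kernel a b) {a b : F.Vec}
    (h : ∀ c, F.kernel c a = F.kernel c b) : f a = f b :=
  hf.ext_inner fun c => by rw [hK, hK, h]

lemma vec_mul_of_mem_stabTri (hf : IsTotal f) (hK : ∀ a b, inner ℂ (f a) (f b) = F.kernel a b)
    (g : triSym) (X : ObjK) (v : F.space X) {d : triSym} (hd : d ∈ stabTri X.level) :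
    f (g * d, ⟨X, v⟩) = f (g, ⟨X, v⟩) :=
  vec_eq hf hK fun c => by
    dsimp only [kernel]
    rw [between_mul_right _ _ hd]

lemma vec_eq_finToTri (hf : IsTotal f) (hK : ∀ a b, inner ℂ (f a) (f b) = F.kernel a b)
    (g : triSym) (X : ObjK) (v : F.space X) :
    f (g, ⟨X, v⟩) = f (finToTri (approx X.level g), ⟨X, v⟩) := by
  have h := vec_mul_of_mem_stabTri hf hK (finToTri (approx X.level g)) X v
    (approx_spec X.level g)
  rwa [mul_inv_cancel_left] at h

/-- Translation by an element supported in the first `N` points is an operator of F with values in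
F(N). This lets vectors based at 1 span a dense subspace. -/
lemma vec_finToTri (hF : F.IsStarRep) (hf : IsTotal f)
    (hK : ∀ a b, inner ℂ (f a) (f b) = F.kernel a b) {x : finTri} {N : ℕ}
    (hx : SuppIn (Finset.range N) x) (X : ObjK) (hX : X.level ≤ N) (v : F.space X) :
    f (finToTri x, ⟨X, v⟩)
      = f (1, ⟨⟨N⟩, F.map (X := X) (Y := ⟨N⟩) (cosetMk N X.level x) v⟩) := by
  refine vec_eq hf hK fun c => ?_
  obtain ⟨h, Y, w⟩ := c
  dsimp only [kernel]
  have e1 : between Y.level X.level h (finToTri x)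
      = cosetMk Y.level X.level ((approx Y.level h)⁻¹ * x) :=
    between_eq (approx_spec _ _) (by simp)
  have e2 : between Y.level N h 1 = cosetMk Y.level N (approx Y.level h)⁻¹ := by
    have := between_eq (n := N) (g := 1) (x := 1) (approx_spec Y.level h) (by simp)
    rwa [mul_one] at this
  rw [e1, e2, ← hF.map_circ (Y := ⟨N⟩), circ_mk_of_suppIn _ hx hX]

lemma isTotal_one (hF : F.IsStarRep) (hf : IsTotal f)
    (hK : ∀ a b, inner ℂ (f a) (f b) = F.kernel a b) :
    IsTotal fun a : Σ X : ObjK, F.space X => f (1, a) := by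
  refine hf.mono (Submodule.span_mono ?_)
  rintro _ ⟨⟨g, X, v⟩, rfl⟩
  obtain ⟨N, hN⟩ := exists_suppIn (approx X.level g)
  rw [vec_eq_finToTri hf hK,
    vec_finToTri hF hf hK (hN (max N X.level) (le_max_left _ _)) X (le_max_right _ _)]
  exact ⟨_, rfl⟩

/-- A continuity criterion for a homomorphism to the unitary group. -/
lemma continuous_of_translate (hf : IsTotal f) (hK : ∀ a b, inner ℂ (f a) (f b) = F.kernel a b)
    (R : triSym → V ≃ₗᵢ[ℂ] V) (hR : ∀ g a, R g (f a) = f (g * a.1, a.2)) (v : V) :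
    Continuous[triTopology, inferInstance] fun g => R g v := by
  rw [continuous_triTopology]
  intro g
  let := permTopology
  let S : Submodule ℂ V :=
    { carrier := {v | Continuous fun k => R (g * diagTri k) v}
      zero_mem' := by simpa using continuous_const
      add_mem' := fun {a b} ha hb => by
        simp only [Set.mem_ofPred_eq, map_add] at ha hb ⊢
        exact ha.add hb
      smul_mem' := fun c a ha => by
        simp only [Set.mem_ofPred_eq, map_smul] at ha ⊢
        exact ha.const_smul c }
  refine hf.mem_of_isClosed S ?_ ?_ v
  -- The operators are isometries, so approximating the vector approximates its orbit map uniformly.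
  · refine isClosed_of_closure_subset fun a ha => ?_
    refine continuous_of_uniform_approx_of_continuous fun r hr => ?_
    obtain ⟨ε, hε, hr⟩ := Metric.mem_uniformity_dist.mp hr
    obtain ⟨b, hb, hab⟩ := Metric.mem_closure_iff.mp ha ε hε
    exact ⟨_, hb, fun k => hr (by rwa [LinearIsometryEquiv.dist_map])⟩
  · rintro ⟨h, X, w⟩
    refine continuous_permTopology_of_eq fun k => ?_
    obtain ⟨N, hN⟩ := exists_suppIn (approx X.level h)
    refine ⟨max N X.level, fun k' hk' => ?_⟩
    -- If `k'` agrees with `k` this far, `k⁻¹ * k'` commutes with the representative of `h` and is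
    -- absorbed by `w`: the orbit map is locally constant.
    have hd : k⁻¹ * k' ∈ stab (max N X.level) := fun i hi =>
      Equiv.Perm.inv_eq_iff_eq.mpr (hk' i hi)
    have hd' := diagTri_mem_stabTri hd
    have hc := (hN _ (le_max_left _ _)).commute_stabTri hd'
    have hk : diagTri k' = diagTri k * diagTri (k⁻¹ * k') := by rw [← map_mul, mul_inv_cancel_left]
    rw [vec_eq_finToTri hf hK, hR, hR, hk]
    dsimp only
    rw [mul_assoc g, mul_assoc (diagTri k), ← hc, ← mul_assoc (diagTri k), ← mul_assoc g,
      vec_mul_of_mem_stabTri hf hK _ X w (stabTri_anti (le_max_right _ _) hd'), mul_assoc]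

end Model

/-- A `*`-representation of `𝒦` gives rise to a unitary representation of the tri-symmetric group on
the completion of the space of formal vectors. -/
lemma exists_unitaryRep (hF : F.IsStarRep) : ∃ (ρ : UnitaryRep.{u}) (f : F.Vec → ρ.space),
    IsTotal f ∧ (∀ a b, inner ℂ (f a) (f b) = F.kernel a b) ∧
      ∀ g a, ρ.rho g (f a) = f (g * a.1, a.2) := by
  obtain ⟨V, _, _, _, f, hf, hK⟩ := exists_total_of_gram F.kernel hF.exists_gram
  have hR : ∀ g : triSym, ∃ R : V ≃ₗᵢ[ℂ] V, ∀ a, R (f a) = f (g * a.1, a.2) := by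
    intro g
    -- The translated family is the same set of vectors reindexed, hence total, and the kernel is
    -- translation invariant.
    refine exists_isometryEquiv hf (hf.mono (Submodule.span_mono ?_)) ?_
    · rintro _ ⟨⟨h, a⟩, rfl⟩
      exact ⟨(g⁻¹ * h, a), by simp⟩
    · intro a b
      rw [hK, hK, kernel_translate]
  choose R hR using hR
  have hRmul : ∀ g h v, R (g * h) v = R g (R h v) := by
    intro g h v
    refine hf.ext_isometry (T := (R h).trans (R g)) (fun a => ?_) v
    rw [LinearIsometryEquiv.trans_apply, hR, hR, hR, mul_assoc]
  have hRone : ∀ v, R 1 v = v := by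
    intro v
    refine hf.ext_isometry (T := LinearIsometryEquiv.refl ℂ V) (fun a => ?_) v
    rw [hR, one_mul]
    rfl
  refine ⟨{ space := V
            rho :=
              { toFun := R
                map_one' := LinearIsometryEquiv.ext hRone
                map_mul' := fun g h => LinearIsometryEquiv.ext (hRmul g h) }
            strongly_continuous := continuous_of_translate hf hK R hR }, f, hf, hK, hR⟩

/-- Every `*`-representation of `𝒦` is equivalent to the family of a unitary representation. -/
lemma exists_barRep_equiv (E : StarRep.{u}) : ∃ ρ : UnitaryRep.{u}, ρ.barRep ≈ E := by
  obtain ⟨F, hF⟩ := E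
  obtain ⟨ρ, f, hf, hK, hρ⟩ := hF.exists_unitaryRep
  -- The natural direction is from F to ρ̄, by v ↦ 1·v.
  refine ⟨ρ, StarRep.setoid.symm' (x := ⟨F, hF⟩) (y := ρ.barRep) ?_⟩
  have hone := isTotal_one hF hf hK
  have hcoef : ∀ (X Y : ObjK) (p : finTri) (v : F.space X) (w : F.space Y),
      inner ℂ (f (1, ⟨Y, w⟩)) (ρ.op p (f (1, ⟨X, v⟩)))
        = inner ℂ w (F.map (X := X) (Y := Y) (cosetMk Y.level X.level p) v) := by
    intro X Y p v w
    have h := between_finToTri Y.level X.level p 1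
    rw [_root_.map_one, inv_one, one_mul] at h
    rw [UnitaryRep.op, hρ, hK]
    dsimp only [kernel]
    rw [mul_one, h]
  have hinner : ∀ (X : ObjK) (v w : F.space X),
      inner ℂ (f (1, ⟨X, w⟩)) (f (1, ⟨X, v⟩)) = inner ℂ w v := by
    intro X v w
    have h := hcoef X X 1 v w
    rwa [ρ.op_fixed_one, hF.map_one] at h
  have hfix : ∀ (X : ObjK) (v : F.space X), f (1, ⟨X, v⟩) ∈ ρ.fixed X.level := by
    intro X v h hh
    rw [UnitaryRep.op, hρ]
    have := vec_mul_of_mem_stabTri hf hK 1 X v (mem_subK_iff.mp hh)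
    rwa [one_mul] at this
  have hinj : ∀ (X : ObjK) (v : F.space X) (c : ρ.space), (∀ Y (w : F.space Y),
      inner ℂ (f (1, ⟨Y, w⟩)) (f (1, ⟨X, v⟩)) = inner ℂ (f (1, ⟨Y, w⟩)) c) → f (1, ⟨X, v⟩) = c :=
    fun X v c h => hone.ext_inner fun a => h a.1 a.2
  have hone' : ∀ (X Y : ObjK) (v : F.space X) (w : F.space Y),
      inner ℂ (f (1, ⟨Y, w⟩)) (f (1, ⟨X, v⟩))
        = inner ℂ w (F.map (X := X) (Y := Y) (cosetMk Y.level X.level 1) v) := by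
    intro X Y v w
    have h := hcoef X Y 1 v w
    rwa [ρ.op_fixed_one] at h
  -- Formal vectors are not linear in `v` by construction; linearity is checked by pairing with the
  -- total family of vectors 1·w.
  let T : ∀ X, F.space X →ₗᵢ[ℂ] ρ.fixed X.level := fun X =>
    { toFun := fun v => ⟨f (1, ⟨X, v⟩), hfix X v⟩
      map_add' := fun v w => Subtype.ext <| hinj _ _ _ fun Y z => by
        rw [Submodule.coe_add, inner_add_right, hone', hone', hone', map_add, inner_add_right]
      map_smul' := fun c v => Subtype.ext <| hinj _ _ _ fun Y z => by
        rw [Submodule.coe_smul, inner_smul_right, hone', hone', map_smul, RingHom.id_apply,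
          inner_smul_right]
      norm_map' := fun v => by
        change ‖f (1, ⟨X, v⟩)‖ = ‖v‖
        rw [norm_eq_sqrt_re_inner (𝕜 := ℂ), norm_eq_sqrt_re_inner (𝕜 := ℂ), hinner] }
  have hT : ∀ X (v : F.space X), (T X v : ρ.space) = f (1, ⟨X, v⟩) := fun _ _ => rfl
  have hproj : ∀ (X Y : ObjK) (w : F.space Y), (ρ.fixed X.level).orthogonalProjectionOnto
      (f (1, ⟨Y, w⟩)) = T X (F.map (X := Y) (Y := X) (cosetMk X.level Y.level 1) w) := by
    intro X Y w
    refine Subtype.ext (hone.ext_inner fun a => ?_)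
    obtain ⟨Z, z⟩ := a
    -- Pairing P[X](1·w) with 1·z gives a matrix element of a composition of two compressions of 1.
    -- By `compress_circ` it is the operator of the ⊛-product, which F also sends to a composition.
    obtain ⟨r, hr⟩ : ∃ r, cosetMk Z.level Y.level r
        = circ (cosetMk Z.level X.level 1) (cosetMk X.level Y.level 1) :=
      ⟨_, DoubleCoset.out_eq' _ _ _⟩
    have h1 := DFunLike.congr_fun (ρ.compress_circ 1 1 hr) (T Y w)
    have h2 := congrArg (inner ℂ (T Z z)) h1
    rw [ContinuousLinearMap.comp_apply, ρ.inner_compress, ρ.inner_compress, hT, hT, hcoef, hr,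
      ρ.op_fixed_one, hF.map_circ] at h2
    rw [hT, hone', h2]
    change _ = inner ℂ _ (((ρ.fixed X.level).orthogonalProjectionOnto (ρ.op 1 (T Y w)) :
      ρ.fixed X.level) : ρ.space)
    rw [ρ.op_fixed_one, hT]
  have hsurj : ∀ X, Function.Surjective (T X) := by
    intro X u
    -- The vectors whose projection lies in the range of `T X` form a closed subspace, as the range
    -- of an isometry on a complete space is closed. By `hproj` it contains a total family, hence
    -- also `u`, which is its own projection.
    have hmem := hone.mem_of_isClosed ((LinearMap.range (T X).toLinearMap).comap
      ((ρ.fixed X.level).orthogonalProjectionOnto : ρ.space →L[ℂ] ρ.fixed X.level).toLinearMap) (by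
        have h : IsClosed (Set.range (T X)) := (T X).isometry.isClosedEmbedding.isClosed_range
        exact h.preimage ((ρ.fixed X.level).orthogonalProjectionOnto).continuous)
      (fun a => ⟨_, (hproj X a.1 a.2).symm⟩) u
    obtain ⟨v, hv⟩ := hmem
    refine ⟨v, hv.trans ?_⟩
    exact Submodule.orthogonalProjectionOnto_mem_subspace_eq_self u
  refine ⟨fun X => LinearIsometryEquiv.ofSurjective (T X) (hsurj X), fun X Y g v => ?_⟩
  obtain ⟨p, rfl⟩ : ∃ p, cosetMk _ _ p = g := ⟨_, DoubleCoset.out_eq' _ _ g⟩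
  change T Y (F.map (X := X) (Y := Y) (cosetMk Y.level X.level p) v)
    = ρ.compress Y.level X.level p (T X v)
  refine ext_inner_left ℂ fun w => ?_
  obtain ⟨w, rfl⟩ := hsurj Y w
  rw [(T Y).inner_map_map, ρ.inner_compress, hT, hT, hcoef]

end IsStarRep

end OperatorFamily

end TriSym

end

theorem mainTheorem3 :
    ∃ h : ∀ ρ : TriSym.UnitaryRep.{u}, ρ.bar.IsStarRep,
      ∃ Φ : Quotient TriSym.UnitaryRep.setoid.{u} → Quotient TriSym.StarRep.setoid.{u},
        (∀ ρ : TriSym.UnitaryRep.{u},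
          Φ (Quotient.mk TriSym.UnitaryRep.setoid ρ)
            = Quotient.mk TriSym.StarRep.setoid ⟨ρ.bar, h ρ⟩) ∧
        Function.Bijective Φ := by
  refine ⟨fun ρ => ρ.bar_isStarRep,
    Quotient.map TriSym.UnitaryRep.barRep fun _ _ h => TriSym.UnitaryRep.bar_equiv h,
    fun ρ => rfl, ?_, ?_⟩
  · intro a b
    refine Quotient.inductionOn₂ a b fun ρ π h => ?_
    exact Quotient.sound (TriSym.UnitaryRep.equiv_of_bar_equiv (Quotient.exact h))
  · intro b
    refine Quotient.inductionOn b fun E => ?_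
    obtain ⟨ρ, h⟩ := TriSym.OperatorFamily.IsStarRep.exists_barRep_equiv E
    exact ⟨Quotient.mk _ ρ, Quotient.sound h⟩
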